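/- Let $1<p<\infty$ and let $\Omega\subset\mathbb R^k$ be compact. For finite nonnegative Borel measures $\mu_1,\mu_2$ on $\Omega$ of equal total mass, let $$W_p(\mu_1,\mu_2)=\Big(\inf_{\pi}\int|x-y|^p\,\pi(dx\,dy)\Big)^{1/p},$$ the infimum being over all nonnegative measures $\pi$ on $\Omega\times\Omega$ with marginals $\mu_1$ and $\mu_2$. For real $d\ge1$, a finite nonnegative Borel measure $\sigma$ on $\Omega$ is called strongly $d$-connected if there are $L,K>0$, an integer $N\ge2$ and a nonzero measure space $(D,d\beta)$ such that for any $x_0,x_1\in\operatorname{supp}\sigma$ there are $n\le N$ points $y_1=x_0,y_2,\dots,y_n=x_1$ of $\operatorname{supp}\sigma$ and $n-1$ measurable maps $\Phi_j:[0,1]\times D\to\operatorname{supp}\sigma$, $j=1,\dots,n-1$, with the following properties: (i) $\Phi_j(\cdot,\beta)$ is $L$-Lipschitz on $[0,1]$ for every $\beta\in D$; (ii) $\Phi_j$ is injective on $(0,1)\times D$, and $\Phi_j(0,\beta)=y_j$, $\Phi_j(1,\beta)=y_{j+1}$ for every $\beta\in D$; (iii) the push-forward under $\Phi_j$ of the measure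 $K s^{d-1}(1-s)^{d-1}\,ds\,d\beta$ is $\le\sigma$. Let $\mu$ be a Borel probability measure on $\Omega$ with $\mu=\sum_{j=1}^m\mu_j$, $m\ge2$, where the $\mu_j$ are nonzero nonnegative measures whose supports $A_j=\operatorname{supp}\mu_j$ are pairwise disjoint, and each $\mu_j$ is strongly $d_j$-connected for some $d_j\ge1$. Let $\nu_+,\nu_-$ be finite nonnegative Borel measures with the same total mass and $\operatorname{supp}\nu_+\cup\operatorname{supp}\nu_-\subset\operatorname{supp}\mu$, and put $\nu=\nu_+-\nu_-$. Let $V=\{1,\dots,m\}$, $\bar\nu_j=\nu(A_j)$, $V_+=\{j:\bar\nu_j>0\}$, $V_-=\{j:\bar\nu_j<0\}$. For $i,j\in V$ let $$|E|_{i,j}=\min_{x\in A_i,\,y\in A_j}|x-y|^p,\qquad |\bar E|_{i,j}=\min\sum_{l=1}^{n-1}|E|_{k_l,k_{l+1}},$$ the second minimum being over all finite sequences $k_1=i,k_2,\dots,k_n=j$ in $V$. Let $$\|\nu\|_\mu=\min_{\lambda}\sum_{i\in V_+}\sum_{j\in V_-}\lambda_{i,j}|\bar E|_{i,j},$$ the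 minimum being over all nonnegative matrices $(\lambda_{i,j})_{i\in V_+,\,j\in V_-}$ with $\sum_{j\in V_-}\lambda_{i,j}=\bar\nu_i$ for $i\in V_+$ and $\sum_{i\in V_+}\lambda_{i,j}=-\bar\nu_j$ for $j\in V_-$. Then $$\lim_{\epsilon\searrow0}\epsilon^{-1/p}\,W_p(\mu+\epsilon\nu_+,\mu+\epsilon\nu_-)=\|\nu\|_\mu^{1/p}.$$ -/

import Mathlib

open MeasureTheory Filter Topology
open scoped ENNReal NNReal

noncomputable section

namespace Teleportation

/-- The couplings (transport plans) of two nonnegative measures. -/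
def couplings {X : Type*} [MeasurableSpace X] (μ₁ μ₂ : Measure X) : Set (Measure (X × X)) :=
  {π | π.map Prod.fst = μ₁ ∧ π.map Prod.snd = μ₂}

/-- The `p`-Wasserstein distance between two nonnegative measures, with values in `[0, ∞]`:
the `p`-th root of the infimum of `∫ |x - y| ^ p dπ` over all couplings `π`. There are no
couplings, and the value is `∞`, if the total masses differ. -/
def wasserstein {X : Type*} [MeasurableSpace X] [PseudoEMetricSpace X] (p : ℝ)
    (μ₁ μ₂ : Measure X) : ℝ≥0∞ :=
  (⨅ π ∈ couplings μ₁ μ₂, ∫⁻ z, edist z.1 z.2 ^ p ∂π) ^ (1 / p)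

/-- The measure on `[0, 1]` with density `K * s ^ (d - 1) * (1 - s) ^ (d - 1)`. -/
def profile (d K : ℝ) : Measure unitInterval :=
  (volume : Measure unitInterval).withDensity
    (fun s => ENNReal.ofReal (K * (s : ℝ) ^ (d - 1) * (1 - (s : ℝ)) ^ (d - 1)))

/-- A measure `μ` is strongly `d`-connected: there are `L, K > 0`, `N ≥ 2` and a nonzero
measure space `(D, β)` such that any two points of the support are joined by a chain
`y 0, …, y n` of at most `N` points of the support, consecutive points being joined by a bundle
`Φ j : [0, 1] × D → supp μ` of `L`-Lipschitz curves, injective on `(0, 1) × D`, which pushes the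
measure `K s ^ (d - 1) (1 - s) ^ (d - 1) ds dβ` forward to a measure below `μ`.

By injectivity `D` embeds into `X` as soon as a single `Φ j` occurs, so that for `X = ℝᵏ`
restricting `D` to `Type` loses nothing; likewise the last condition forces `β` to be finite
when `μ` is. -/
def IsStronglyConnected {X : Type*} [MeasurableSpace X] [PseudoMetricSpace X]
    (d : ℝ) (μ : Measure X) : Prop :=
  ∃ (L : ℝ≥0) (K : ℝ) (N : ℕ) (D : Type) (_ : MeasurableSpace D) (β : Measure D),
    0 < L ∧ 0 < K ∧ 2 ≤ N ∧ IsFiniteMeasure β ∧ β ≠ 0 ∧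
    ∀ x₀ ∈ μ.support, ∀ x₁ ∈ μ.support,
      ∃ (n : ℕ) (y : Fin (n + 1) → X) (Φ : Fin n → unitInterval × D → X),
        n + 1 ≤ N ∧ y 0 = x₀ ∧ y (Fin.last n) = x₁ ∧ (∀ j, y j ∈ μ.support) ∧
        ∀ j : Fin n,
          Measurable (Φ j) ∧
          (∀ z, Φ j z ∈ μ.support) ∧
          (∀ b : D, LipschitzWith L (fun s => Φ j (s, b))) ∧
          Set.InjOn (Φ j) (Set.Ioo 0 1 ×ˢ Set.univ) ∧
          (∀ b : D, Φ j (0, b) = y j.castSucc ∧ Φ j (1, b) = y j.succ) ∧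
          ((profile d K).prod β).map (Φ j) ≤ μ

/-- The distance between two sets, `inf |x - y|` over `x ∈ A`, `y ∈ B`
(the minimum, for nonempty compact sets). -/
def setDist {X : Type*} [PseudoMetricSpace X] (A B : Set X) : ℝ :=
  sInf {r | ∃ x ∈ A, ∃ y ∈ B, r = dist x y}

/-- The geodesic distance from `i` to `j` on the complete graph with vertices `V` and edge
lengths `E`: the least length of an orbit `k 0 = i, k 1, …, k n = j`. -/
def geodesic {V : Type*} (E : V → V → ℝ) (i j : V) : ℝ :=
  sInf {r | ∃ (n : ℕ) (k : Fin (n + 1) → V), k 0 = i ∧ k (Fin.last n) = j ∧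
    r = ∑ l : Fin n, E (k l.castSucc) (k l.succ)}

/-- The nonnegative matrices indexed by positively and negatively charged vertices whose
row sums are the positive charges `c i` and whose column sums are the charges `-c j`. -/
def transportPlans {V : Type*} [Fintype V] (c : V → ℝ) :
    Set ({i : V // 0 < c i} → {j : V // c j < 0} → ℝ) :=
  {Λ | (∀ i j, 0 ≤ Λ i j) ∧ (∀ i, ∑ j, Λ i j = c i) ∧ (∀ j, ∑ i, Λ i j = -c j)}

/-- The optimal cost of transporting the positive charges to the negative ones, for the
cost `δ` (a minimum over a compact polytope, nonempty if the charges sum to zero). -/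
def graphCost {V : Type*} [Fintype V] (c : V → ℝ) (δ : V → V → ℝ) : ℝ :=
  sInf {r | ∃ Λ ∈ transportPlans c,
    r = ∑ i : {i : V // 0 < c i}, ∑ j : {j : V // c j < 0}, Λ i j * δ i j}

/-- The functional `‖ν‖_μ` of `ν = νp - νm` for a measure with support components `A j`:
the optimal transport cost of the charges `ν (A j)` on the complete graph of components with
edge lengths `dist (A i, A j) ^ p`, with respect to its geodesic distance. -/
def teleportCost {X : Type*} [MeasurableSpace X] [PseudoMetricSpace X] {V : Type*} [Fintype V]
    (p : ℝ) (A : V → Set X) (νp νm : Measure X) : ℝ :=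
  graphCost (fun j => νp.real (A j) - νm.real (A j))
    (geodesic (fun i j => setDist (A i) (A j) ^ p))

end Teleportation

end

noncomputable section

namespace Teleportation

/-! ### Couplings and the `p`-th power of the Wasserstein distance. -/

section TransportCost

variable {X : Type*} [MeasurableSpace X]

/-! The natural quantity is the `p`-th power of the distance: as an infimum of a linear functional
of the coupling it is subadditive and homogeneous. Mass of order ε can be relayed through μ: mass
arriving at a point of `supp μ` stays there while other mass leaves from that point. A journey
therefore costs the sum of the `p`-th powers of its hops, and `n` hops of length `L / n` cost `L ^ p
* n ^ (1 - p)`, which tends to 0 as `p > 1`. Inside a component, transport is asymptotically free;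
only the jumps between components cost.

This is formalized by `catalyticCost`, where an auxiliary measure `F ≤ C • μ` is added on both
sides. As `ε • F ≤ μ` for small ε, it bounds the upper limit of the rescaled cost
(`eventually_transportCost_le`), and it obeys a triangle inequality through catalysts
(`catalyticCost_triangle`), although a `p`-th power of a distance need not.

Upper bound (`catalyticCost_le_teleportCost`): collapse the part of each charge in `A j` to a small
ball in `A j`, then move mass between these balls along an arbitrary transport plan and along paths
in the graph.

Lower bound (`mul_teleportCost_le_transportCost`): for each ε, a coupling π gives the flow `π (A i
×ˢ A j) / ε` on the graph. The contributions of μ cancel in its divergence, and flows can be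
rerouted into transport plans without increasing the cost (`exists_transportPlan_le`). -/

theorem couplings_add {α α' β β' : Measure X} {π π' : Measure (X × X)}
    (h : π ∈ couplings α β) (h' : π' ∈ couplings α' β') :
    π + π' ∈ couplings (α + α') (β + β') :=
  ⟨by rw [Measure.map_add _ _ measurable_fst, h.1, h'.1],
    by rw [Measure.map_add _ _ measurable_snd, h.2, h'.2]⟩

theorem couplings_smul {α β : Measure X} {π : Measure (X × X)} (c : ℝ≥0∞)
    (h : π ∈ couplings α β) : c • π ∈ couplings (c • α) (c • β) :=
  ⟨by rw [Measure.map_smul, h.1], by rw [Measure.map_smul, h.2]⟩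

variable [PseudoEMetricSpace X]

/-- The infimum of `∫ |x - y| ^ p dπ` over all couplings, i.e. the `p`-th power of the
Wasserstein distance. -/
def transportCost (p : ℝ) (α β : Measure X) : ℝ≥0∞ :=
  ⨅ π ∈ couplings α β, ∫⁻ z, edist z.1 z.2 ^ p ∂π

theorem wasserstein_eq (p : ℝ) (α β : Measure X) :
    wasserstein p α β = transportCost p α β ^ (1 / p) := rfl

theorem transportCost_le {p : ℝ} {α β : Measure X} {π : Measure (X × X)}
    (h : π ∈ couplings α β) : transportCost p α β ≤ ∫⁻ z, edist z.1 z.2 ^ p ∂π :=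
  iInf₂_le π h

theorem transportCost_add_le (p : ℝ) (α α' β β' : Measure X) :
    transportCost p (α + α') (β + β') ≤ transportCost p α β + transportCost p α' β' := by
  conv_rhs => simp only [transportCost, ENNReal.iInf_add, ENNReal.add_iInf]
  refine le_iInf₂ fun π' hπ' => le_iInf₂ fun π hπ => ?_
  exact (transportCost_le (couplings_add hπ hπ')).trans (lintegral_add_measure _ _ _).le

/-- The product coupling suffices: it is concentrated on `s ×ˢ t`. -/
theorem transportCost_le_of_edist_le {p : ℝ} (hp : 0 ≤ p) (α β : Measure X) [IsFiniteMeasure α]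
    [IsProbabilityMeasure β] {R : ℝ≥0∞} {s t : Set X} (hs : α sᶜ = 0) (ht : β tᶜ = 0)
    (h : ∀ x ∈ s, ∀ y ∈ t, edist x y ≤ R) :
    transportCost p α (α Set.univ • β) ≤ α Set.univ * R ^ p := by
  refine (transportCost_le (π := α.prod β) ⟨by simp, by simp⟩).trans ?_
  have h1 : ∀ᵐ z ∂α.prod β, edist z.1 z.2 ^ p ≤ R ^ p := by
    have h2 : ∀ᵐ z ∂α.prod β, z.1 ∈ s :=
      Measure.quasiMeasurePreserving_fst.ae (p := fun x => x ∈ s) hs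
    have h3 : ∀ᵐ z ∂α.prod β, z.2 ∈ t :=
      Measure.quasiMeasurePreserving_snd.ae (p := fun x => x ∈ t) ht
    filter_upwards [h2, h3] with z hz hz'
    exact ENNReal.rpow_le_rpow (h _ hz _ hz') hp
  refine (lintegral_mono_ae h1).trans ?_
  rw [lintegral_const, ← Set.univ_prod_univ, Measure.prod_prod]
  simp [mul_comm]

theorem transportCost_zero (p : ℝ) : transportCost p (0 : Measure X) 0 = 0 :=
  nonpos_iff_eq_zero.1 <| (transportCost_le (π := 0) ⟨by simp, by simp⟩).trans (by simp)

theorem transportCost_smul_le (p : ℝ) {c : ℝ≥0∞} (hc : c ≠ ∞) (α β : Measure X) :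
    transportCost p (c • α) (c • β) ≤ c * transportCost p α β := by
  -- For `c = 0` the factor does not commute with an infimum over an empty family, where `0 * ∞ =
  -- 0`.
  rcases eq_or_ne c 0 with rfl | h0
  · simp [transportCost_zero]
  · conv_rhs => simp only [transportCost, ENNReal.mul_iInf_of_ne h0 hc]
    refine le_iInf₂ fun π hπ => ?_
    exact (transportCost_le (couplings_smul c hπ)).trans (lintegral_smul_measure _ _).le

end TransportCost

/-! ### Diagonal and swapped couplings. -/

section TransportCostBorel

variable {X : Type*} [MeasurableSpace X] [PseudoEMetricSpace X] [OpensMeasurableSpace X]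
  [SecondCountableTopology X]

theorem measurable_edist_rpow (p : ℝ) : Measurable fun z : X × X => edist z.1 z.2 ^ p :=
  measurable_edist.pow_const p

theorem transportCost_self {p : ℝ} (hp : 0 < p) (α : Measure X) : transportCost p α α = 0 := by
  have hm : Measurable fun x : X => (x, x) := measurable_id.prodMk measurable_id
  refine nonpos_iff_eq_zero.1 <| (transportCost_le (π := α.map fun x => (x, x)) ⟨?_, ?_⟩).trans ?_
  · rw [Measure.map_map measurable_fst hm]; exact Measure.map_id
  · rw [Measure.map_map measurable_snd hm]; exact Measure.map_id
  · rw [lintegral_map (measurable_edist_rpow p) hm]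
    simp [hp]

theorem transportCost_comm_le (p : ℝ) (α β : Measure X) :
    transportCost p α β ≤ transportCost p β α := by
  refine le_iInf₂ fun π hπ => ?_
  refine (transportCost_le (π := π.map Prod.swap) ⟨?_, ?_⟩).trans ?_
  · rw [Measure.map_map measurable_fst measurable_swap]; exact hπ.2
  · rw [Measure.map_map measurable_snd measurable_swap]; exact hπ.1
  · rw [lintegral_map (measurable_edist_rpow p) measurable_swap]
    simp [edist_comm]

theorem transportCost_comm (p : ℝ) (α β : Measure X) :
    transportCost p α β = transportCost p β α :=
  (transportCost_comm_le p α β).antisymm (transportCost_comm_le p β α)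

end TransportCostBorel

/-! ### Catalysts and the triangle inequality. -/

section CatalyticCost

variable {X : Type*} [MeasurableSpace X]

/-- A measure is a catalyst for `μ` if it is bounded by a finite multiple of `μ`. -/
def IsCatalyst (μ F : Measure X) : Prop := ∃ C : ℝ≥0, F ≤ C • μ

theorem isCatalyst_zero (μ : Measure X) : IsCatalyst μ 0 := ⟨0, by simp⟩

theorem IsCatalyst.add {μ F G : Measure X} (hF : IsCatalyst μ F) (hG : IsCatalyst μ G) :
    IsCatalyst μ (F + G) := by
  obtain ⟨C, hC⟩ := hF
  obtain ⟨C', hC'⟩ := hG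
  exact ⟨C + C', by rw [add_smul]; exact add_le_add hC hC'⟩

theorem IsCatalyst.smul {μ F : Measure X} (hF : IsCatalyst μ F) {c : ℝ≥0∞} (hc : c ≠ ∞) :
    IsCatalyst μ (c • F) := by
  obtain ⟨C, hC⟩ := hF
  lift c to ℝ≥0 using hc
  refine ⟨c * C, ?_⟩
  rw [mul_smul]
  intro s
  have h := mul_le_mul_right (hC s) (c : ℝ≥0∞)
  simp only [Measure.smul_apply, smul_eq_mul, ENNReal.smul_def] at h ⊢
  exact h

theorem IsCatalyst.sum {ι : Type*} {μ : Measure X} {F : ι → Measure X} (s : Finset ι)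
    (h : ∀ i ∈ s, IsCatalyst μ (F i)) : IsCatalyst μ (∑ i ∈ s, F i) := by
  classical
  induction s using Finset.induction_on with
  | empty => simpa using isCatalyst_zero μ
  | insert a s ha ih =>
    rw [Finset.sum_insert ha]
    exact (h a (by simp)).add (ih fun i hi => h i (by simp [hi]))

variable [PseudoEMetricSpace X]

/-- The infimum of the transport costs from `α + F` to `β + F` over all catalysts `F`. -/
def catalyticCost (p : ℝ) (μ α β : Measure X) : ℝ≥0∞ :=
  ⨅ F ∈ {F | IsCatalyst μ F}, transportCost p (α + F) (β + F)

theorem catalyticCost_le {p : ℝ} {μ α β F : Measure X} (hF : IsCatalyst μ F) :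
    catalyticCost p μ α β ≤ transportCost p (α + F) (β + F) :=
  iInf₂_le F hF

theorem catalyticCost_le_transportCost (p : ℝ) (μ α β : Measure X) :
    catalyticCost p μ α β ≤ transportCost p α β := by
  simpa using catalyticCost_le (p := p) (α := α) (β := β) (isCatalyst_zero μ)

theorem catalyticCost_add_le (p : ℝ) (μ α α' β β' : Measure X) :
    catalyticCost p μ (α + α') (β + β') ≤ catalyticCost p μ α β + catalyticCost p μ α' β' := by
  conv_rhs => simp only [catalyticCost, ENNReal.iInf_add, ENNReal.add_iInf]
  refine le_iInf₂ fun F hF => le_iInf₂ fun F' hF' => ?_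
  refine (catalyticCost_le (hF'.add hF)).trans (le_trans (le_of_eq ?_)
    (transportCost_add_le p _ _ _ _))
  congr 1 <;> abel

theorem catalyticCost_zero (p : ℝ) (μ : Measure X) : catalyticCost p μ 0 0 = 0 :=
  nonpos_iff_eq_zero.1 <| (catalyticCost_le_transportCost p μ 0 0).trans (transportCost_zero p).le

theorem catalyticCost_smul_le (p : ℝ) (μ : Measure X) {c : ℝ≥0∞} (hc : c ≠ ∞) (α β : Measure X) :
    catalyticCost p μ (c • α) (c • β) ≤ c * catalyticCost p μ α β := by
  rcases eq_or_ne c 0 with rfl | h0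
  · simp [catalyticCost_zero]
  · conv_rhs => simp only [catalyticCost, ENNReal.mul_iInf_of_ne h0 hc]
    refine le_iInf₂ fun F hF => ?_
    refine (catalyticCost_le (hF.smul hc)).trans ?_
    rw [← smul_add, ← smul_add]
    exact transportCost_smul_le p hc _ _

theorem catalyticCost_sum_le {ι : Type*} (p : ℝ) (μ : Measure X) (s : Finset ι)
    (α β : ι → Measure X) :
    catalyticCost p μ (∑ i ∈ s, α i) (∑ i ∈ s, β i) ≤ ∑ i ∈ s, catalyticCost p μ (α i) (β i) := by
  classical
  induction s using Finset.induction_on with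
  | empty => simp [catalyticCost_zero]
  | insert a s ha ih =>
    simp only [Finset.sum_insert ha]
    exact (catalyticCost_add_le _ _ _ _ _ _).trans (by gcongr)

/-- The transports from α to β and from β to γ run simultaneously: a copy of β is present at the
start, feeds the second transport, and is restored by the first. This needs β itself to be a
catalyst. -/
theorem catalyticCost_triangle (p : ℝ) {μ : Measure X} (α γ : Measure X) {β : Measure X}
    (hβ : IsCatalyst μ β) :
    catalyticCost p μ α γ ≤ catalyticCost p μ α β + catalyticCost p μ β γ := by
  conv_rhs => simp only [catalyticCost, ENNReal.iInf_add, ENNReal.add_iInf]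
  refine le_iInf₂ fun F hF => le_iInf₂ fun F' hF' => ?_
  refine (catalyticCost_le ((hF'.add hβ).add hF)).trans (le_trans (le_of_eq ?_)
    (transportCost_add_le p _ _ _ _))
  congr 1 <;> abel

variable [OpensMeasurableSpace X] [SecondCountableTopology X]

theorem catalyticCost_comm (p : ℝ) (μ α β : Measure X) :
    catalyticCost p μ α β = catalyticCost p μ β α := by
  simp only [catalyticCost, transportCost_comm p (α + _)]

theorem catalyticCost_self {p : ℝ} (hp : 0 < p) (μ α : Measure X) :
    catalyticCost p μ α α = 0 :=
  nonpos_iff_eq_zero.1 <|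
    (catalyticCost_le_transportCost p μ α α).trans (transportCost_self hp α).le

/-- In the presence of `μ`, a catalyst can be used to transport small masses. -/
theorem eventually_transportCost_le {p : ℝ} (hp : 0 < p) {μ F : Measure X} [IsFiniteMeasure μ]
    (hF : IsCatalyst μ F) (α β : Measure X) :
    ∀ᶠ ε : ℝ in 𝓝[>] 0,
      transportCost p (μ + ENNReal.ofReal ε • α) (μ + ENNReal.ofReal ε • β) ≤
        ENNReal.ofReal ε * transportCost p (α + F) (β + F) := by
  obtain ⟨C, hC⟩ := hF
  -- Below this threshold `ε * C ≤ 1`, hence `ε • F ≤ μ`; the `+ 1` covers `C = 0`.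
  have hpos : (0 : ℝ) < 1 / (C + 1) := by positivity
  filter_upwards [Ioo_mem_nhdsGT hpos] with ε hε
  have hle : ENNReal.ofReal ε • F ≤ μ := by
    have h1 : ENNReal.ofReal ε * C ≤ 1 := by
      rw [← ENNReal.ofReal_coe_nnreal, ← ENNReal.ofReal_mul hε.1.le, ENNReal.ofReal_le_one]
      have := hε.2.le
      rw [le_div_iff₀ (by positivity)] at this
      nlinarith [hε.1]
    intro s
    calc (ENNReal.ofReal ε • F) s = ENNReal.ofReal ε * F s := by simp
      _ ≤ ENNReal.ofReal ε * (C * μ s) := by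
        have := hC s
        gcongr
        simpa using this
      _ = ENNReal.ofReal ε * C * μ s := by ring
      _ ≤ 1 * μ s := by gcongr
      _ = μ s := one_mul _
  have : IsFiniteMeasure (ENNReal.ofReal ε • F) := isFiniteMeasure_of_le μ hle
  have hsub : μ - ENNReal.ofReal ε • F + ENNReal.ofReal ε • F = μ := Measure.sub_add_cancel_of_le hle
  -- The part `ε • F` of μ acts as the catalyst; the remainder of μ stays in place at no cost.
  have key : ∀ α : Measure X, μ + ENNReal.ofReal ε • α =
      (μ - ENNReal.ofReal ε • F) + ENNReal.ofReal ε • (α + F) := fun α => by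
    conv_lhs => rw [← hsub]
    rw [smul_add, add_assoc, add_comm (ENNReal.ofReal ε • F)]
  rw [key α, key β]
  refine (transportCost_add_le p _ _ _ _).trans ?_
  rw [transportCost_self hp, zero_add]
  exact transportCost_smul_le p ENNReal.ofReal_ne_top _ _

end CatalyticCost

/-! ### Subadditivity of upper limits, and chains. -/

section Limsup

theorem limsup_add_le_add {ι : Type*} {l : Filter ι} (u v : ι → ℝ≥0∞) :
    limsup (fun i => u i + v i) l ≤ limsup u l + limsup v l := by
  refine ENNReal.le_of_forall_pos_le_add fun ε hε hlt => ?_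
  have hε2 : ((ε / 2 : ℝ≥0) : ℝ≥0∞) ≠ 0 := by simpa using hε.ne'
  have hu := eventually_lt_of_limsup_lt
    (ENNReal.lt_add_right (ENNReal.add_lt_top.1 hlt).1.ne hε2)
  have hv := eventually_lt_of_limsup_lt
    (ENNReal.lt_add_right (ENNReal.add_lt_top.1 hlt).2.ne hε2)
  have heq : (ε : ℝ≥0∞) = (ε / 2 : ℝ≥0) + (ε / 2 : ℝ≥0) := by
    rw [← ENNReal.coe_add, add_halves]
  refine limsup_le_of_le (by isBoundedDefault) ?_
  filter_upwards [hu, hv] with i hi hi'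
  refine (add_le_add hi.le hi'.le).trans_eq ?_
  rw [heq, add_add_add_comm]

theorem limsup_sum_mul_le {ι κ : Type*} {l : Filter ι} (s : Finset κ) {m : κ → ℝ≥0∞}
    (hm : ∀ k, m k ≠ ∞) (u : κ → ι → ℝ≥0∞) :
    limsup (fun i => ∑ k ∈ s, m k * u k i) l ≤ ∑ k ∈ s, m k * limsup (u k) l := by
  classical
  induction s using Finset.induction_on with
  | empty =>
    simp only [Finset.sum_empty]
    exact limsup_const_bot.le
  | insert a s ha ih =>
    simp only [Finset.sum_insert ha]
    refine (limsup_add_le_add _ _).trans (add_le_add ?_ ih)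
    rw [ENNReal.limsup_const_mul_of_ne_top (hm a)]

/-- The triangle inequality is required only on `S`, because `pointCost_triangle` needs its
intermediate point in the support. -/
theorem le_sum_chain {V : Type*} (S : Set V) (δ : V → V → ℝ≥0∞) (h0 : ∀ x ∈ S, δ x x = 0)
    (htri : ∀ x ∈ S, ∀ y ∈ S, ∀ z ∈ S, δ x z ≤ δ x y + δ y z) :
    ∀ (n : ℕ) (y : Fin (n + 1) → V), (∀ i, y i ∈ S) →
      δ (y 0) (y (Fin.last n)) ≤ ∑ l : Fin n, δ (y l.castSucc) (y l.succ)
  | 0, y, hy => by simp [h0 _ (hy _)]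
  | n + 1, y, hy => by
    rw [Fin.sum_univ_castSucc]
    refine (htri _ (hy _) _ (hy (Fin.last n).castSucc) _ (hy _)).trans (add_le_add ?_ le_rfl)
    exact le_sum_chain S δ h0 htri n (fun i => y i.castSucc) fun i => hy _

end Limsup

/-! ### Unit masses near points of the support, and free transport along curves. -/

section Smear

variable {X : Type*} [MeasurableSpace X] [PseudoMetricSpace X]

/-- The normalized restriction of `μ` to the ball of radius `r` around `x`. -/
def smear (μ : Measure X) (x : X) (r : ℝ) : Measure X :=
  ProbabilityTheory.cond μ (Metric.ball x r)

theorem measure_ball_ne_zero {μ : Measure X} {x : X} (hx : x ∈ μ.support) {r : ℝ} (hr : 0 < r) :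
    μ (Metric.ball x r) ≠ 0 :=
  ((Measure.mem_support_iff_forall x).1 hx _ (Metric.ball_mem_nhds x hr)).ne'

theorem isProbabilityMeasure_smear {μ : Measure X} [IsFiniteMeasure μ] {x : X}
    (hx : x ∈ μ.support) {r : ℝ} (hr : 0 < r) : IsProbabilityMeasure (smear μ x r) :=
  ProbabilityTheory.cond_isProbabilityMeasure (measure_ball_ne_zero hx hr)

/-- The reason for smearing: a Dirac mass need not lie below a multiple of μ, whereas a ball around
a support point has positive mass, so the normalizing constant is finite. -/
theorem isCatalyst_smear {μ : Measure X} {x : X} (hx : x ∈ μ.support) {r : ℝ} (hr : 0 < r) :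
    IsCatalyst μ (smear μ x r) := by
  refine ⟨(μ (Metric.ball x r))⁻¹.toNNReal, fun s => ?_⟩
  have hne : (μ (Metric.ball x r))⁻¹ ≠ ∞ := by simpa using measure_ball_ne_zero hx hr
  simp only [smear, ProbabilityTheory.cond, Measure.smul_apply, smul_eq_mul, ENNReal.smul_def,
    ENNReal.coe_toNNReal hne]
  gcongr
  exact Measure.restrict_le_self

/-- The asymptotic catalytic cost of transporting a unit mass from near `x` to near `y`. -/
def pointCost (p : ℝ) (μ : Measure X) (x y : X) : ℝ≥0∞ :=
  limsup (fun r : ℝ => catalyticCost p μ (smear μ x r) (smear μ y r)) (𝓝[>] 0)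

theorem pointCost_triangle (p : ℝ) {μ : Measure X} (x z : X) {y : X} (hy : y ∈ μ.support) :
    pointCost p μ x z ≤ pointCost p μ x y + pointCost p μ y z := by
  refine le_trans ?_ (limsup_add_le_add _ _)
  refine limsup_le_limsup ?_
  filter_upwards [self_mem_nhdsWithin] with r hr
  exact catalyticCost_triangle p _ _ (isCatalyst_smear hy hr)

/-- One parameter `b` is fixed, so that each bundle becomes a single curve; it exists because `β ≠
0`. The mass for relaying along the curve is found near its points since they lie in the support. -/
theorem IsStronglyConnected.exists_chain {σ : Measure X} {d : ℝ} (hσ : IsStronglyConnected d σ)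
    {x y : X} (hx : x ∈ σ.support) (hy : y ∈ σ.support) :
    ∃ (L : ℝ≥0) (n : ℕ) (z : Fin (n + 1) → X) (γ : Fin n → unitInterval → X),
      z 0 = x ∧ z (Fin.last n) = y ∧ (∀ j, z j ∈ σ.support) ∧ ∀ j,
        LipschitzWith L (γ j) ∧ (∀ s, γ j s ∈ σ.support) ∧
          γ j 0 = z j.castSucc ∧ γ j 1 = z j.succ := by
  obtain ⟨L, K, N, D, mD, β, hL, hK, hN, hf, hβ, h⟩ := hσ
  have hD : Nonempty D := by
    by_contra hD
    rw [not_nonempty_iff] at hD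
    exact hβ (Measure.eq_zero_of_isEmpty β)
  obtain ⟨b⟩ := hD
  obtain ⟨n, z, Φ, -, h0, h1, hz, hΦ⟩ := h x hx y hy
  refine ⟨L, n, z, fun j s => Φ j (s, b), h0, h1, hz, fun j => ?_⟩
  have hj := hΦ j
  exact ⟨hj.2.2.1 b, fun s => hj.2.1 _, (hj.2.2.2.2.1 b).1, (hj.2.2.2.2.1 b).2⟩

variable [OpensMeasurableSpace X]

theorem smear_compl (μ : Measure X) (x : X) (r : ℝ) : smear μ x r (Metric.ball x r)ᶜ = 0 := by
  simp [smear, ProbabilityTheory.cond, Measure.restrict_apply Metric.isOpen_ball.measurableSet.compl]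

variable [SecondCountableTopology X]

theorem transportCost_smear_le {p : ℝ} (hp : 0 ≤ p) {μ α : Measure X} [IsFiniteMeasure μ]
    [IsFiniteMeasure α] {R : ℝ≥0∞} {s : Set X} (hs : α sᶜ = 0) {y : X} (hy : y ∈ μ.support)
    {r : ℝ} (hr : 0 < r) (h : ∀ x ∈ s, edist x y ≤ R) :
    transportCost p α (α Set.univ • smear μ y r) ≤ α Set.univ * (R + ENNReal.ofReal r) ^ p := by
  have := isProbabilityMeasure_smear hy hr
  refine transportCost_le_of_edist_le hp α _ hs (smear_compl μ y r) fun x hx z hz => ?_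
  refine (edist_triangle x y z).trans (add_le_add (h x hx) ?_)
  rw [edist_comm, edist_dist]
  exact ENNReal.ofReal_le_ofReal (Metric.mem_ball.1 hz).le

theorem pointCost_self {p : ℝ} (hp : 0 < p) (μ : Measure X) (x : X) : pointCost p μ x x = 0 := by
  simp only [pointCost, catalyticCost_self hp]
  exact limsup_const_bot

theorem tendsto_add_ofReal_rpow {p : ℝ} (a : ℝ≥0∞) (c : ℝ) :
    Tendsto (fun r : ℝ => (a + ENNReal.ofReal (c * r)) ^ p) (𝓝[>] 0) (𝓝 (a ^ p)) := by
  have h1 : Tendsto (fun r : ℝ => ENNReal.ofReal (c * r)) (𝓝[>] 0) (𝓝 0) := by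
    have : Continuous fun r : ℝ => ENNReal.ofReal (c * r) :=
      ENNReal.continuous_ofReal.comp (continuous_const.mul continuous_id)
    simpa using (this.tendsto 0).mono_left nhdsWithin_le_nhds
  have h2 := (tendsto_const_nhds (x := a)).add h1
  rw [add_zero] at h2
  exact (ENNReal.continuous_rpow_const.tendsto a).comp h2

/-- Direct transport between the two balls of radius `r` moves mass by at most `edist x y + 2 * r`;
then `r → 0`. -/
theorem pointCost_le {p : ℝ} (hp : 0 ≤ p) {μ : Measure X} [IsFiniteMeasure μ] {x y : X}
    (hx : x ∈ μ.support) (hy : y ∈ μ.support) : pointCost p μ x y ≤ edist x y ^ p := by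
  rw [← (tendsto_add_ofReal_rpow (p := p) (edist x y) 2).limsup_eq]
  refine limsup_le_limsup ?_
  filter_upwards [self_mem_nhdsWithin] with r hr
  have hr : 0 < r := hr
  have := isProbabilityMeasure_smear hx hr
  refine (catalyticCost_le_transportCost p _ _ _).trans ?_
  have := transportCost_smear_le hp (R := ENNReal.ofReal r + edist x y) (smear_compl μ x r) hy hr
    fun z hz => (edist_triangle z x y).trans (add_le_add (by
      rw [edist_dist]
      exact ENNReal.ofReal_le_ofReal (Metric.mem_ball.1 hz).le) le_rfl)
  simp only [measure_univ, one_smul, one_mul] at this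
  refine this.trans_eq ?_
  rw [two_mul, ENNReal.ofReal_add hr.le hr.le]
  congr 1
  ring

theorem pointCost_chain_le {p : ℝ} (hp : 0 < p) {μ : Measure X} {n : ℕ} (y : Fin (n + 1) → X)
    (hy : ∀ i, y i ∈ μ.support) :
    pointCost p μ (y 0) (y (Fin.last n)) ≤
      ∑ l : Fin n, pointCost p μ (y l.castSucc) (y l.succ) :=
  le_sum_chain μ.support (pointCost p μ) (fun x _ => pointCost_self hp μ x)
    (fun x _ _ hy z _ => pointCost_triangle p x z hy) n y hy

/-- Subdividing a Lipschitz curve in the support makes the cost arbitrarily small as `p > 1`. -/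
theorem pointCost_eq_zero_of_lipschitzWith {p : ℝ} (hp : 1 < p) {μ : Measure X}
    [IsFiniteMeasure μ] {L : ℝ≥0} {γ : unitInterval → X} (hγ : LipschitzWith L γ)
    (hmem : ∀ s, γ s ∈ μ.support) : pointCost p μ (γ 0) (γ 1) = 0 := by
  have hp0 : 0 < p := by linarith
  -- Extending the curve to ℝ avoids membership proofs for the subdivision points.
  let f : ℝ → X := fun t => γ (Set.projIcc 0 1 zero_le_one t)
  have hf : LipschitzWith L f := by
    have h := hγ.comp (LipschitzWith.projIcc (zero_le_one (α := ℝ)))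
    rwa [mul_one] at h
  -- There are `n + 1` hops of cost at most `(L / (n + 1)) ^ p` each.
  have hbound : ∀ n : ℕ, pointCost p μ (γ 0) (γ 1) ≤
      ENNReal.ofReal ((L : ℝ) ^ p * ((n + 1 : ℕ) : ℝ) ^ (-(p - 1))) := fun n => by
    have hn : (0 : ℝ) < ((n + 1 : ℕ) : ℝ) := by positivity
    have h := pointCost_chain_le hp0 (μ := μ) (n := n + 1)
      (fun i => f ((i : ℕ) / ((n + 1 : ℕ) : ℝ))) fun i => hmem _
    have h0 : f (((0 : Fin (n + 1 + 1)) : ℕ) / ((n + 1 : ℕ) : ℝ)) = γ 0 := by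
      simp [f]
    have h1 : f ((Fin.last (n + 1) : ℕ) / ((n + 1 : ℕ) : ℝ)) = γ 1 := by
      simp only [Fin.val_last, div_self hn.ne', f, Set.projIcc_right]
      rfl
    rw [h0, h1] at h
    refine h.trans ?_
    have hstep : ∀ l : Fin (n + 1),
        pointCost p μ (f ((l.castSucc : ℕ) / ((n + 1 : ℕ) : ℝ)))
          (f ((l.succ : ℕ) / ((n + 1 : ℕ) : ℝ))) ≤
        ENNReal.ofReal ((L / ((n + 1 : ℕ) : ℝ)) ^ p) := fun l => by
      refine (pointCost_le hp0.le (hmem _) (hmem _)).trans ?_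
      rw [edist_dist, ENNReal.ofReal_rpow_of_nonneg dist_nonneg hp0.le]
      refine ENNReal.ofReal_le_ofReal (Real.rpow_le_rpow dist_nonneg ?_ hp0.le)
      refine (hf.dist_le_mul _ _).trans (le_of_eq ?_)
      rw [Real.dist_eq, ← sub_div, abs_div, abs_of_pos hn, Fin.val_castSucc, Fin.val_succ]
      push_cast
      rw [show (l : ℝ) - (l + 1) = -1 by ring]
      simp [div_eq_mul_inv]
    refine (Finset.sum_le_sum fun l _ => hstep l).trans (le_of_eq ?_)
    rw [Finset.sum_const, Finset.card_univ, Fintype.card_fin, nsmul_eq_mul,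
      ← ENNReal.ofReal_natCast, ← ENNReal.ofReal_mul hn.le]
    congr 1
    rw [Real.div_rpow (NNReal.coe_nonneg L) hn.le, neg_sub, Real.rpow_sub hn, Real.rpow_one]
    ring
  have hlim : Tendsto (fun n : ℕ => ENNReal.ofReal ((L : ℝ) ^ p * ((n + 1 : ℕ) : ℝ) ^ (-(p - 1))))
      atTop (𝓝 0) := by
    have h := (tendsto_rpow_neg_atTop (y := p - 1) (by linarith)).comp
      (tendsto_natCast_atTop_atTop.comp (tendsto_add_atTop_nat 1))
    have h' := ENNReal.tendsto_ofReal (h.const_mul ((L : ℝ) ^ p))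
    simpa using h'
  exact nonpos_iff_eq_zero.1 (ge_of_tendsto' hlim hbound)

theorem IsStronglyConnected.pointCost_eq_zero {p : ℝ} (hp : 1 < p) {μ σ : Measure X}
    [IsFiniteMeasure μ] {d : ℝ} (hσ : IsStronglyConnected d σ) (hle : σ.support ⊆ μ.support)
    {x y : X} (hx : x ∈ σ.support) (hy : y ∈ σ.support) : pointCost p μ x y = 0 := by
  obtain ⟨L, n, z, γ, h0, h1, hz, hγ⟩ := hσ.exists_chain hx hy
  have hp0 : 0 < p := by linarith
  have h := pointCost_chain_le hp0 (μ := μ) z fun i => hle (hz i)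
  rw [h0, h1] at h
  refine nonpos_iff_eq_zero.1 (h.trans (Finset.sum_eq_zero fun j _ => ?_).le)
  obtain ⟨hL, hmem, hs, ht⟩ := hγ j
  rw [← hs, ← ht]
  exact pointCost_eq_zero_of_lipschitzWith hp hL fun s => hle (hmem s)

end Smear

/-! ### Flows on a finite graph and their reduction to transport plans. -/

section Flow

variable {V : Type*} [Fintype V]

/-- Rerouting the flow through `v` along direct edges, so that afterwards no flow leaves `v` or
no flow enters `v`. -/
theorem exists_flow_rerouted {δ : V → V → ℝ} (htri : ∀ i j k, δ i k ≤ δ i j + δ j k) (v : V)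
    {f : V → V → ℝ} (hf : ∀ i j, 0 ≤ f i j) (hv : f v v = 0) :
    ∃ g : V → V → ℝ, (∀ i j, 0 ≤ g i j) ∧
      (∀ i, ∑ j, g i j - ∑ j, g j i = ∑ j, f i j - ∑ j, f j i) ∧
      ∑ i, ∑ j, g i j * δ i j ≤ ∑ i, ∑ j, f i j * δ i j ∧
      ((∀ j, g v j = 0) ∨ ∀ j, g j v = 0) ∧
      (∀ u, (∀ j, f u j = 0) → ∀ j, g u j = 0) ∧
      (∀ u, (∀ j, f j u = 0) → ∀ j, g j u = 0) := by
  classical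
  set I := ∑ i, f i v with hI
  set O := ∑ j, f v j with hO
  set M := max I O with hM
  have hI0 : 0 ≤ I := Finset.sum_nonneg fun i _ => hf i v
  have hO0 : 0 ≤ O := Finset.sum_nonneg fun j _ => hf v j
  have hM0 : 0 ≤ M := hI0.trans (le_max_left _ _)
  have hIM : I / M ≤ 1 := div_le_one_of_le₀ (le_max_left _ _) hM0
  have hOM : O / M ≤ 1 := div_le_one_of_le₀ (le_max_right _ _) hM0
  -- Each passage `i → v → j` is replaced by a direct edge carrying `f i v * f v j / M`. This uses
  -- up the fraction `O / M` of the inflow and `I / M` of the outflow; by the choice of `M` one of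
  -- these is 1, unless `I = O = 0`, when nothing changes.
  let g : V → V → ℝ := fun i j => f i j + f i v * f v j / M
    - (if i = v then f v j * (I / M) else 0) - (if j = v then f i v * (O / M) else 0)
  have hgv : ∀ j, j ≠ v → g v j = f v j * (1 - I / M) := fun j hj => by
    simp [g, hj, hv]; ring
  have hgv' : ∀ i, i ≠ v → g i v = f i v * (1 - O / M) := fun i hi => by
    simp [g, hi, hv]; ring
  have hgvv : g v v = 0 := by simp [g, hv]
  -- Row and column sums drop by the same amount, and only at `v`, so the divergence is preserved.
  have hrow : ∀ i, ∑ j, g i j = ∑ j, f i j - if i = v then O * (I / M) else 0 := fun i => by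
    simp only [g, Finset.sum_sub_distrib, Finset.sum_add_distrib, ← Finset.sum_div,
      ← Finset.mul_sum, Finset.sum_ite_eq', Finset.mem_univ, if_true, ← hO]
    split_ifs with h
    · rw [← Finset.sum_mul, ← hO]; ring
    · simp; ring
  have hcol : ∀ j, ∑ i, g i j = ∑ i, f i j - if j = v then O * (I / M) else 0 := fun j => by
    simp only [g, Finset.sum_sub_distrib, Finset.sum_add_distrib, ← Finset.sum_div,
      ← Finset.sum_mul, Finset.sum_ite_eq', Finset.mem_univ, if_true, ← hI]
    split_ifs with h
    · rw [← Finset.sum_mul, ← hI]; ring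
    · simp; ring
  refine ⟨g, fun i j => ?_, fun i => ?_, ?_, ?_, fun u hu j => ?_, fun u hu j => ?_⟩
  · by_cases hi : i = v
    · by_cases hj : j = v
      · rw [hi, hj, hgvv]
      · rw [hi, hgv j hj]
        exact mul_nonneg (hf _ _) (by linarith)
    · by_cases hj : j = v
      · rw [hj, hgv' i hi]
        exact mul_nonneg (hf _ _) (by linarith)
      · simp only [g, hi, hj, if_false, sub_zero]
        have := hf i v; have := hf v j; have := hf i j
        positivity
  · rw [hrow, hcol]; ring
  · have e1 : ∑ i, ∑ j, g i j * δ i j = ∑ i, ∑ j, f i j * δ i j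
        + ∑ i, ∑ j, f i v * f v j / M * δ i j
        - ∑ j, f v j * (I / M) * δ v j - ∑ i, f i v * (O / M) * δ i v := by
      simp only [g, sub_mul, add_mul, Finset.sum_sub_distrib, Finset.sum_add_distrib, ite_mul,
        zero_mul, Finset.sum_ite_eq', Finset.mem_univ, if_true]
      congr 2
      rw [Finset.sum_comm]
      simp
    have e2 : ∑ i, ∑ j, f i v * f v j / M * δ i j ≤
        ∑ i, ∑ j, f i v * f v j / M * (δ i v + δ v j) := by
      refine Finset.sum_le_sum fun i _ => Finset.sum_le_sum fun j _ => ?_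
      exact mul_le_mul_of_nonneg_left (htri _ _ _)
        (div_nonneg (mul_nonneg (hf _ _) (hf _ _)) hM0)
    have e3 : ∑ i, ∑ j, f i v * f v j / M * (δ i v + δ v j) =
        ∑ i, f i v * (O / M) * δ i v + ∑ j, f v j * (I / M) * δ v j := by
      simp only [mul_add, Finset.sum_add_distrib]
      congr 1
      · refine Finset.sum_congr rfl fun i _ => ?_
        rw [← Finset.sum_mul, ← Finset.sum_div, ← Finset.mul_sum, ← hO]
        ring
      · rw [Finset.sum_comm]
        refine Finset.sum_congr rfl fun i _ => ?_
        rw [← Finset.sum_mul, ← Finset.sum_div, ← Finset.sum_mul, ← hI]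
        ring
    linarith
  · rcases le_total I O with h | h
    · right
      intro j
      by_cases hj : j = v
      · rw [hj, hgvv]
      · rw [hgv' j hj]
        have hMO : M = O := max_eq_right h
        rcases eq_or_ne O 0 with h0 | h0
        · have : f j v = 0 := (Finset.sum_eq_zero_iff_of_nonneg fun i _ => hf i v).1
            (le_antisymm (h.trans h0.le) hI0) j (Finset.mem_univ _)
          rw [this, zero_mul]
        · rw [hMO, div_self h0]; ring
    · left
      intro j
      by_cases hj : j = v
      · rw [hj, hgvv]
      · rw [hgv j hj]
        have hMI : M = I := max_eq_left h
        rcases eq_or_ne I 0 with h0 | h0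
        · have : f v j = 0 := (Finset.sum_eq_zero_iff_of_nonneg fun i _ => hf v i).1
            (le_antisymm (h.trans h0.le) hO0) j (Finset.mem_univ _)
          rw [this, zero_mul]
        · rw [hMI, div_self h0]; ring
  · simp only [g, hu, zero_mul, zero_div, add_zero, ite_self, sub_zero, zero_sub, neg_eq_zero]
    split_ifs with h
    · subst h; rw [hu j, zero_mul]
    · rfl
  · simp only [g, hu, mul_zero, zero_mul, zero_div, add_zero, ite_self, zero_sub, sub_zero,
      neg_eq_zero]
    split_ifs with h
    · subst h; rw [hu j, zero_mul]
    · rfl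

/-- Every nonnegative flow can be replaced, without changing its divergence or increasing its
cost, by one for which every vertex of `S` is a pure sink or a pure source. -/
theorem exists_flow_pure {δ : V → V → ℝ} (h0 : ∀ i j, 0 ≤ δ i j)
    (htri : ∀ i j k, δ i k ≤ δ i j + δ j k) (S : Finset V) {f : V → V → ℝ}
    (hf : ∀ i j, 0 ≤ f i j) :
    ∃ g : V → V → ℝ, (∀ i j, 0 ≤ g i j) ∧
      (∀ i, ∑ j, g i j - ∑ j, g j i = ∑ j, f i j - ∑ j, f j i) ∧
      ∑ i, ∑ j, g i j * δ i j ≤ ∑ i, ∑ j, f i j * δ i j ∧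
      ∀ u ∈ S, (∀ j, g u j = 0) ∨ ∀ j, g j u = 0 := by
  classical
  induction S using Finset.induction_on with
  | empty => exact ⟨f, hf, fun _ => rfl, le_rfl, by simp⟩
  | insert v S hvS ih =>
    obtain ⟨f₁, hf₁, hdiv, hcost, hpure⟩ := ih
    -- Rerouting requires no loop at `v`, but earlier reroutings may have created one. Deleting it
    -- keeps the divergence and does not raise the cost.
    let f₂ : V → V → ℝ := fun i j => f₁ i j - if i = v then (if j = v then f₁ v v else 0) else 0
    have hf₂ : ∀ i j, 0 ≤ f₂ i j := fun i j => by
      simp only [f₂]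
      split_ifs with hi hj
      · rw [hi, hj]; simp
      · simpa using hf₁ i j
      · simpa using hf₁ i j
    have hle : ∀ i j, f₂ i j ≤ f₁ i j := fun i j => by
      have := hf₁ v v
      simp only [f₂]
      split_ifs <;> linarith
    obtain ⟨g, hg, hdiv', hcost', hv, hsrc, hsnk⟩ :=
      exists_flow_rerouted htri v hf₂ (by simp [f₂])
    refine ⟨g, hg, fun i => ?_, ?_, fun u hu => ?_⟩
    · rw [hdiv', ← hdiv]
      simp only [f₂, Finset.sum_sub_distrib, Finset.sum_ite_eq', Finset.mem_univ, if_true]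
      split_ifs <;> simp
    · refine hcost'.trans (le_trans ?_ hcost)
      exact Finset.sum_le_sum fun i _ => Finset.sum_le_sum fun j _ =>
        mul_le_mul_of_nonneg_right (hle i j) (h0 i j)
    · rcases Finset.mem_insert.1 hu with rfl | hu
      · exact hv
      · rcases hpure u hu with h | h
        · exact Or.inl (hsrc u fun j => le_antisymm ((hle u j).trans (h j).le) (hf₂ _ _))
        · exact Or.inr (hsnk u fun j => le_antisymm ((hle j u).trans (h j).le) (hf₂ _ _))

theorem sum_subtype_of_eq_zero (P : V → Prop) [DecidablePred P] {g : V → ℝ}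
    (h : ∀ j, ¬ P j → g j = 0) : ∑ j : {j // P j}, g j = ∑ j, g j := by
  rw [← Finset.sum_subtype (Finset.univ.filter P) (by simp) g]
  exact Finset.sum_filter_of_ne fun j _ hj => by_contra fun hP => hj (h j hP)

/-- Every flow with divergence `c` is at least as expensive as some transport plan for `c`. -/
theorem exists_transportPlan_le {δ : V → V → ℝ} (h0 : ∀ i j, 0 ≤ δ i j)
    (htri : ∀ i j k, δ i k ≤ δ i j + δ j k) {c : V → ℝ} {f : V → V → ℝ}
    (hf : ∀ i j, 0 ≤ f i j) (hc : ∀ i, ∑ j, f i j - ∑ j, f j i = c i) :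
    ∃ Λ ∈ transportPlans c,
      ∑ i : {i // 0 < c i}, ∑ j : {j // c j < 0}, Λ i j * δ i j ≤ ∑ i, ∑ j, f i j * δ i j := by
  -- Once every vertex is pure, the sign of `c` decides its type: positive charges only emit,
  -- negative ones only receive, and neutral vertices carry no flow.
  obtain ⟨g, hg, hdiv, hcost, hpure⟩ := exists_flow_pure h0 htri Finset.univ hf
  have hdiv' : ∀ i, ∑ j, g i j - ∑ j, g j i = c i := fun i => (hdiv i).trans (hc i)
  have hpos : ∀ i, 0 < c i → ∀ j, g j i = 0 := fun i hi => by
    refine (hpure i (Finset.mem_univ i)).resolve_left fun h => ?_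
    have h1 := hdiv' i
    have h2 : 0 ≤ ∑ j, g j i := Finset.sum_nonneg fun j _ => hg j i
    simp only [h, Finset.sum_const_zero] at h1
    linarith
  have hneg : ∀ i, c i < 0 → ∀ j, g i j = 0 := fun i hi => by
    refine (hpure i (Finset.mem_univ i)).resolve_right fun h => ?_
    have h1 := hdiv' i
    have h2 : 0 ≤ ∑ j, g i j := Finset.sum_nonneg fun j _ => hg i j
    simp only [h, Finset.sum_const_zero] at h1
    linarith
  have hzero : ∀ i j, ¬ c j < 0 → g i j = 0 := fun i j hj => by
    rcases hpure j (Finset.mem_univ j) with h | h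
    · have h1 := hdiv' j
      simp only [h, Finset.sum_const_zero, zero_sub] at h1
      exact (Finset.sum_eq_zero_iff_of_nonneg fun i _ => hg i j).1
        (le_antisymm (by linarith) (Finset.sum_nonneg fun i _ => hg i j)) i (Finset.mem_univ i)
    · exact h i
  have hzero' : ∀ i j, ¬ 0 < c i → g i j = 0 := fun i j hi => by
    rcases hpure i (Finset.mem_univ i) with h | h
    · exact h j
    · have h1 := hdiv' i
      simp only [h, Finset.sum_const_zero, sub_zero] at h1
      exact (Finset.sum_eq_zero_iff_of_nonneg fun j _ => hg i j).1
        (le_antisymm (by linarith) (Finset.sum_nonneg fun j _ => hg i j)) j (Finset.mem_univ j)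
  refine ⟨fun i j => g i j, ⟨fun i j => hg i j, fun i => ?_, fun j => ?_⟩, ?_⟩
  · rw [sum_subtype_of_eq_zero (fun j => c j < 0) (g := fun j => g i j) (hzero i), ← hdiv' i]
    simp [hpos i i.2]
  · rw [sum_subtype_of_eq_zero (fun i => 0 < c i) (g := fun i => g i j) fun i => hzero' i j,
      ← hdiv' j]
    simp [hneg j j.2]
  · refine le_trans (le_of_eq ?_) hcost
    rw [← sum_subtype_of_eq_zero (fun i => 0 < c i) (g := fun i => ∑ j, g i j * δ i j)
      fun i hi => Finset.sum_eq_zero fun j _ => by rw [hzero' i j hi, zero_mul]]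
    refine Finset.sum_congr rfl fun i _ => ?_
    exact sum_subtype_of_eq_zero (fun j => c j < 0) (g := fun j => g i j * δ i j)
      fun j hj => by rw [hzero i j hj, zero_mul]

theorem graphCost_le_of_plan {δ : V → V → ℝ} (h0 : ∀ i j, 0 ≤ δ i j) {c : V → ℝ}
    {Λ : {i : V // 0 < c i} → {j : V // c j < 0} → ℝ} (hΛ : Λ ∈ transportPlans c) :
    graphCost c δ ≤ ∑ i : {i // 0 < c i}, ∑ j : {j // c j < 0}, Λ i j * δ i j := by
  refine csInf_le ⟨0, ?_⟩ ⟨Λ, hΛ, rfl⟩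
  rintro r ⟨Λ', hΛ', rfl⟩
  exact Finset.sum_nonneg fun i _ => Finset.sum_nonneg fun j _ => mul_nonneg (hΛ'.1 i j) (h0 _ _)

theorem graphCost_le_of_flow {δ : V → V → ℝ} (h0 : ∀ i j, 0 ≤ δ i j)
    (htri : ∀ i j k, δ i k ≤ δ i j + δ j k) {c : V → ℝ} {f : V → V → ℝ}
    (hf : ∀ i j, 0 ≤ f i j) (hc : ∀ i, ∑ j, f i j - ∑ j, f j i = c i) :
    graphCost c δ ≤ ∑ i, ∑ j, f i j * δ i j := by
  obtain ⟨Λ, hΛ, hle⟩ := exists_transportPlan_le h0 htri hf hc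
  exact (graphCost_le_of_plan h0 hΛ).trans hle

theorem graphCost_nonneg {δ : V → V → ℝ} (h0 : ∀ i j, 0 ≤ δ i j) (c : V → ℝ) :
    0 ≤ graphCost c δ := by
  refine Real.sInf_nonneg ?_
  rintro r ⟨Λ', hΛ', rfl⟩
  exact Finset.sum_nonneg fun i _ => Finset.sum_nonneg fun j _ => mul_nonneg (hΛ'.1 i j) (h0 _ _)

/-- The normalized product flow has divergence `a i - b i`; reducing it for the zero cost yields a
plan. -/
theorem transportPlans_nonempty {a b : V → ℝ} (ha : ∀ i, 0 ≤ a i) (hb : ∀ i, 0 ≤ b i)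
    (hab : ∑ i, a i = ∑ i, b i) : (transportPlans fun i => a i - b i).Nonempty := by
  obtain ⟨Λ, hΛ, -⟩ := exists_transportPlan_le (δ := fun _ _ : V => 0) (by simp) (by simp)
    (c := fun i => a i - b i) (f := fun i j => a i * b j / ∑ i, a i)
    (fun i j => div_nonneg (mul_nonneg (ha i) (hb j)) (Finset.sum_nonneg fun i _ => ha i))
    fun i => by
      rw [← Finset.sum_div, ← Finset.mul_sum, ← Finset.sum_div, ← Finset.sum_mul, ← hab]
      rcases eq_or_ne (∑ i, a i) 0 with h | h
      · have h1 := (Finset.sum_eq_zero_iff_of_nonneg fun i _ => ha i).1 h i (Finset.mem_univ i)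
        have h2 := (Finset.sum_eq_zero_iff_of_nonneg fun i _ => hb i).1 (hab ▸ h) i
          (Finset.mem_univ i)
        simp [h1, h2]
      · field_simp
  exact ⟨Λ, hΛ⟩

end Flow

/-! ### Geodesic distance on the graph of components. -/

section Geodesic

variable {V : Type*} {E : V → V → ℝ}

theorem geodesic_bddBelow (hE : ∀ i j, 0 ≤ E i j) (i j : V) :
    BddBelow {r | ∃ (n : ℕ) (k : Fin (n + 1) → V), k 0 = i ∧ k (Fin.last n) = j ∧
      r = ∑ l : Fin n, E (k l.castSucc) (k l.succ)} := by
  refine ⟨0, ?_⟩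
  rintro r ⟨n, k, -, -, rfl⟩
  exact Finset.sum_nonneg fun l _ => hE _ _

theorem geodesic_set_nonempty (i j : V) :
    {r | ∃ (n : ℕ) (k : Fin (n + 1) → V), k 0 = i ∧ k (Fin.last n) = j ∧
      r = ∑ l : Fin n, E (k l.castSucc) (k l.succ)}.Nonempty :=
  ⟨_, 1, ![i, j], rfl, rfl, rfl⟩

theorem geodesic_nonneg (hE : ∀ i j, 0 ≤ E i j) (i j : V) : 0 ≤ geodesic E i j := by
  refine Real.sInf_nonneg ?_
  rintro r ⟨n, k, -, -, rfl⟩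
  exact Finset.sum_nonneg fun l _ => hE _ _

theorem geodesic_le (hE : ∀ i j, 0 ≤ E i j) (i j : V) : geodesic E i j ≤ E i j :=
  csInf_le (geodesic_bddBelow hE i j) ⟨1, ![i, j], rfl, rfl, by simp⟩

theorem geodesic_le_add (hE : ∀ i j, 0 ≤ E i j) (i j k : V) :
    geodesic E i k ≤ E i j + geodesic E j k := by
  rw [← sub_le_iff_le_add']
  refine le_csInf (geodesic_set_nonempty j k) ?_
  rintro r ⟨n, u, rfl, rfl, rfl⟩
  rw [sub_le_iff_le_add']
  refine csInf_le (geodesic_bddBelow hE _ _) ⟨n + 1, Fin.cons i u, by simp, ?_, ?_⟩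
  · rw [← Fin.succ_last, Fin.cons_succ]
  · rw [Fin.sum_univ_succ]
    simp

/-- The edges of a path from `i` to `j` are prepended one at a time, which avoids concatenating
paths. -/
theorem geodesic_triangle (hE : ∀ i j, 0 ≤ E i j) (i j k : V) :
    geodesic E i k ≤ geodesic E i j + geodesic E j k := by
  rw [← sub_le_iff_le_add]
  refine le_csInf (geodesic_set_nonempty i j) ?_
  rintro r ⟨n, u, rfl, rfl, rfl⟩
  rw [sub_le_iff_le_add]
  induction n with
  | zero => simp
  | succ n ih =>
    have h := ih fun l => u l.succ
    rw [Fin.sum_univ_succ]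
    exact ((geodesic_le_add hE _ (u 1) k).trans (add_le_add le_rfl h)).trans_eq
      (add_assoc _ _ _).symm

end Geodesic

/-- Passes from extended costs to real infima; nonemptiness matters because `sInf ∅ = 0` in ℝ. -/
theorem le_ofReal_csInf {S : Set ℝ} (hne : S.Nonempty) {a : ℝ≥0∞} (h0 : ∀ r ∈ S, 0 ≤ r)
    (h : ∀ r ∈ S, a ≤ ENNReal.ofReal r) : a ≤ ENNReal.ofReal (sInf S) := by
  obtain ⟨r, hr⟩ := hne
  have ha : a ≠ ∞ := ne_top_of_le_ne_top ENNReal.ofReal_ne_top (h r hr)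
  rw [← ENNReal.ofReal_toReal ha]
  exact ENNReal.ofReal_le_ofReal
    (le_csInf ⟨r, hr⟩ fun s hs => ENNReal.toReal_le_of_le_ofReal (h0 s hs) (h s hs))

/-! ### Cutting measures into small pieces. -/

section Pieces

variable {X : Type*} [MeasurableSpace X]

theorem eq_sum_restrict {ι : Type*} {α : Measure X} (s : Finset ι) {B : ι → Set X}
    (hB : ∀ i ∈ s, MeasurableSet (B i)) (hd : (s : Set ι).PairwiseDisjoint B)
    (h : α (⋃ i ∈ s, B i)ᶜ = 0) : α = ∑ i ∈ s, α.restrict (B i) := by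
  ext t ht
  rw [Measure.finsetSum_apply]
  simp only [Measure.restrict_apply ht]
  rw [← measure_biUnion_finset (hd.mono fun i => Set.inter_subset_right)
    fun i hi => ht.inter (hB i hi), ← Set.inter_iUnion₂]
  exact (measure_inter_conull h).symm

theorem exists_simpleFunc_edist_le {X : Type*} [MeasurableSpace X] [PseudoMetricSpace X]
    [OpensMeasurableSpace X] {A : Set X} (hA : IsCompact A) (hne : A.Nonempty)
    {r : ℝ} (hr : 0 < r) :
    ∃ q : SimpleFunc X X, (∀ x, q x ∈ A) ∧ ∀ x ∈ A, edist x (q x) ≤ ENNReal.ofReal r := by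
  obtain ⟨t, htA, htf, hcov⟩ := hA.finite_cover_balls hr
  have htne : t.Nonempty := by
    obtain ⟨x, hx⟩ := hne
    obtain ⟨c, hc, -⟩ := Set.mem_iUnion₂.1 (hcov hx)
    exact ⟨c, hc⟩
  obtain ⟨e, rfl⟩ := htf.countable.exists_eq_range htne
  choose! k hk using fun c (hc : c ∈ Set.range e) => hc
  -- The cutoff is large enough for the first points of `e` to include every center of the cover.
  refine ⟨SimpleFunc.nearestPt e (htf.toFinset.sup k), fun x => htA ⟨_, rfl⟩, fun x hx => ?_⟩
  obtain ⟨c, hc, hxc⟩ := Set.mem_iUnion₂.1 (hcov hx)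
  rw [edist_comm]
  refine (SimpleFunc.edist_nearestPt_le e x
    (Finset.le_sup (f := k) (htf.mem_toFinset.2 hc))).trans ?_
  rw [hk c hc, edist_comm, edist_dist]
  exact ENNReal.ofReal_le_ofReal (Metric.mem_ball.1 hxc).le

end Pieces

/-! ### Collapsing a measure inside one component. -/

section Collapse

variable {X : Type*} [MeasurableSpace X] [MetricSpace X] [BorelSpace X]
  [SecondCountableTopology X]

/-- A measure on a set all of whose points are at cost zero from `x₀` can be collapsed to `x₀`
at asymptotically no cost. -/
theorem limsup_catalyticCost_collapse {p : ℝ} (hp : 0 < p) {μ α : Measure X} [IsFiniteMeasure μ]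
    [IsFiniteMeasure α] {A : Set X} (hA : IsCompact A) (hAμ : A ⊆ μ.support) (hα : α Aᶜ = 0)
    {x₀ : X} (hx₀ : x₀ ∈ A) (h0 : ∀ y ∈ A, pointCost p μ y x₀ = 0) :
    limsup (fun r : ℝ => catalyticCost p μ α (α Set.univ • smear μ x₀ r)) (𝓝[>] 0) = 0 := by
  -- At a fixed scale `R`, each piece moves to a smear at its net point at cost mass times `(R + r)
  -- ^ p`, and from there to `x₀` at a cost vanishing as `r → 0`; only then `R → 0`. The right side
  -- has the form of `tendsto_add_ofReal_rpow`.
  have hbound : ∀ R : ℝ, 0 < R →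
      limsup (fun r : ℝ => catalyticCost p μ α (α Set.univ • smear μ x₀ r)) (𝓝[>] 0) ≤
        α Set.univ * (0 + ENNReal.ofReal (1 * R)) ^ p := fun R hR => by
    obtain ⟨q, hqA, hq⟩ := exists_simpleFunc_edist_le hA ⟨x₀, hx₀⟩ hR
    have hα' : α = ∑ c ∈ q.range, α.restrict (q ⁻¹' {c}) := by
      refine eq_sum_restrict q.range (fun c _ => q.measurableSet_fiber c) ?_ ?_
      · intro c _ c' _ hcc'
        refine Set.disjoint_left.2 fun x hx hx' => hcc' ?_
        exact (Set.mem_singleton_iff.1 hx).symm.trans hx'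
      · rw [show (⋃ c ∈ q.range, q ⁻¹' {c})ᶜ = (∅ : Set X) by ext x; simp]
        exact measure_empty
    have hmass : α Set.univ = ∑ c ∈ q.range, α (q ⁻¹' {c}) := by
      conv_lhs => rw [hα']
      simp
    have hpt : ∀ᶠ r : ℝ in 𝓝[>] 0, catalyticCost p μ α (α Set.univ • smear μ x₀ r) ≤
        α Set.univ * (ENNReal.ofReal R + ENNReal.ofReal (1 * r)) ^ p +
          ∑ c ∈ q.range, α (q ⁻¹' {c}) * catalyticCost p μ (smear μ c r) (smear μ x₀ r) := by
      filter_upwards [self_mem_nhdsWithin] with r hr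
      have hr : 0 < r := hr
      have hmem : ∀ c ∈ q.range, c ∈ A := fun c hc => by
        obtain ⟨x, rfl⟩ := SimpleFunc.mem_range.1 hc
        exact hqA x
      have hcat : IsCatalyst μ (∑ c ∈ q.range, α (q ⁻¹' {c}) • smear μ c r) :=
        IsCatalyst.sum _ fun c hc =>
          (isCatalyst_smear (hAμ (hmem c hc)) hr).smul (measure_ne_top α _)
      refine (catalyticCost_triangle p _ _ hcat).trans (add_le_add ?_ ?_)
      · conv_lhs => rw [hα']
        refine (catalyticCost_sum_le p μ _ _ _).trans ?_
        rw [hmass, Finset.sum_mul]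
        refine Finset.sum_le_sum fun c hc => (catalyticCost_le_transportCost p _ _ _).trans ?_
        rw [← hα', one_mul]
        have := transportCost_smear_le hp.le (α := α.restrict (q ⁻¹' {c}))
          (s := q ⁻¹' {c} ∩ A) (R := ENNReal.ofReal R) ?_ (hAμ (hmem c hc)) hr ?_
        · simpa using this
        · rw [Set.compl_inter]
          refine measure_union_null ?_ (Measure.absolutelyContinuous_of_le
            Measure.restrict_le_self hα)
          rw [Measure.restrict_apply (q.measurableSet_fiber c).compl]
          simp
        · rintro x ⟨hx, hxA⟩
          rw [← Set.mem_singleton_iff.1 hx]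
          exact hq x hxA
      · rw [hmass, Finset.sum_smul]
        refine (catalyticCost_sum_le p μ _ _ _).trans (Finset.sum_le_sum fun c _ => ?_)
        exact catalyticCost_smul_le p μ (measure_ne_top α _) _ _
    refine (limsup_le_limsup hpt).trans ((limsup_add_le_add _ _).trans ?_)
    rw [ENNReal.limsup_const_mul_of_ne_top (measure_ne_top α _),
      (tendsto_add_ofReal_rpow (ENNReal.ofReal R) 1).limsup_eq, zero_add, one_mul]
    refine (add_le_add le_rfl (limsup_sum_mul_le _ (fun c => measure_ne_top α _) _)).trans_eq ?_
    rw [Finset.sum_eq_zero, add_zero]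
    intro c hc
    obtain ⟨x, rfl⟩ := SimpleFunc.mem_range.1 hc
    change _ * pointCost p μ _ x₀ = 0
    rw [h0 _ (hqA x), mul_zero]
  have hlim := ENNReal.Tendsto.const_mul (a := α Set.univ)
    (tendsto_add_ofReal_rpow (p := p) 0 1) (Or.inr (measure_ne_top α _))
  rw [ENNReal.zero_rpow_of_pos hp, mul_zero] at hlim
  refine nonpos_iff_eq_zero.1 (ge_of_tendsto hlim ?_)
  filter_upwards [self_mem_nhdsWithin] with R hR
  exact hbound R hR

end Collapse

/-! ### Realizing a transport plan between smeared vertices. -/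

section Plan

variable {X : Type*} [MeasurableSpace X] [PseudoEMetricSpace X] [OpensMeasurableSpace X]
  [SecondCountableTopology X] {V : Type*} [Fintype V]

/-- The common mass `min (a i) (b i)` at each vertex stays put; the rows of Λ split the surpluses
and its columns the deficits. -/
theorem catalyticCost_plan_le {p : ℝ} (hp : 0 < p) (μ : Measure X) (S : V → Measure X)
    {a b : V → ℝ} (ha : ∀ i, 0 ≤ a i) (hb : ∀ i, 0 ≤ b i)
    {Λ : {i : V // 0 < a i - b i} → {j : V // a j - b j < 0} → ℝ}
    (hΛ : Λ ∈ transportPlans fun i => a i - b i) :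
    catalyticCost p μ (∑ i, ENNReal.ofReal (a i) • S i) (∑ i, ENNReal.ofReal (b i) • S i) ≤
      ∑ z : {i : V // 0 < a i - b i} × {j : V // a j - b j < 0},
        ENNReal.ofReal (Λ z.1 z.2) * catalyticCost p μ (S z.1) (S z.2) := by
  classical
  obtain ⟨h0, hrow, hcol⟩ := hΛ
  have hsplit : ∀ a b : ℝ, 0 ≤ a → 0 ≤ b →
      ENNReal.ofReal a = ENNReal.ofReal (min a b) + ENNReal.ofReal (a - b) := fun a b ha hb => by
    rcases le_total a b with h | h
    · rw [min_eq_left h, ENNReal.ofReal_of_nonpos (sub_nonpos.2 h), add_zero]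
    · rw [min_eq_right h, ← ENNReal.ofReal_add hb (sub_nonneg.2 h), add_sub_cancel]
  have hA : ∑ i, ENNReal.ofReal (a i) • S i = ∑ i, ENNReal.ofReal (min (a i) (b i)) • S i +
      ∑ z : {i : V // 0 < a i - b i} × {j : V // a j - b j < 0},
        ENNReal.ofReal (Λ z.1 z.2) • S z.1 := by
    have h1 : ∀ i : {i : V // 0 < a i - b i},
        ∑ j, ENNReal.ofReal (Λ i j) • S i = ENNReal.ofReal (a i - b i) • S i := fun i => by
      rw [← Finset.sum_smul, ← ENNReal.ofReal_sum_of_nonneg fun j _ => h0 i j, hrow]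
    rw [Fintype.sum_prod_type]
    simp only [h1]
    rw [← Finset.sum_subtype (Finset.univ.filter fun i => 0 < a i - b i) (by simp)
      (fun i => ENNReal.ofReal (a i - b i) • S i), Finset.sum_filter_of_ne,
      ← Finset.sum_add_distrib]
    · refine Finset.sum_congr rfl fun i _ => ?_
      rw [← add_smul, ← hsplit _ _ (ha i) (hb i)]
    · intro i _ hi
      by_contra hle
      exact hi (by rw [ENNReal.ofReal_of_nonpos (not_lt.1 hle), zero_smul])
  have hB : ∑ i, ENNReal.ofReal (b i) • S i = ∑ i, ENNReal.ofReal (min (a i) (b i)) • S i +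
      ∑ z : {i : V // 0 < a i - b i} × {j : V // a j - b j < 0},
        ENNReal.ofReal (Λ z.1 z.2) • S z.2 := by
    have h1 : ∀ j : {j : V // a j - b j < 0},
        ∑ i, ENNReal.ofReal (Λ i j) • S j = ENNReal.ofReal (b j - a j) • S j := fun j => by
      rw [← Finset.sum_smul, ← ENNReal.ofReal_sum_of_nonneg fun i _ => h0 i j, hcol, neg_sub]
    rw [Fintype.sum_prod_type_right]
    simp only [h1]
    rw [← Finset.sum_subtype (Finset.univ.filter fun i => a i - b i < 0) (by simp)
      (fun i => ENNReal.ofReal (b i - a i) • S i), Finset.sum_filter_of_ne,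
      ← Finset.sum_add_distrib]
    · refine Finset.sum_congr rfl fun i _ => ?_
      rw [← add_smul, min_comm, ← hsplit _ _ (hb i) (ha i)]
    · intro i _ hi
      by_contra hle
      exact hi (by rw [ENNReal.ofReal_of_nonpos (by linarith), zero_smul])
  rw [hA, hB]
  refine (catalyticCost_add_le _ _ _ _ _ _).trans ?_
  rw [catalyticCost_self hp, zero_add]
  refine (catalyticCost_sum_le p μ _ _ _).trans (Finset.sum_le_sum fun z _ => ?_)
  exact catalyticCost_smul_le p μ ENNReal.ofReal_ne_top _ _

end Plan

/-! ### Supports, distances between sets and edge lengths. -/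

theorem support_sum {X ι : Type*} [TopologicalSpace X] [MeasurableSpace X] (s : Finset ι)
    (μ : ι → Measure X) : (∑ i ∈ s, μ i).support = ⋃ i ∈ s, (μ i).support := by
  classical
  induction s using Finset.induction_on with
  | empty => simp
  | insert a s ha ih => rw [Finset.sum_insert ha, Measure.support_add, ih, Finset.set_biUnion_insert]

theorem setDist_nonneg {X : Type*} [PseudoMetricSpace X] (A B : Set X) : 0 ≤ setDist A B := by
  refine Real.sInf_nonneg ?_
  rintro r ⟨x, -, y, -, rfl⟩
  exact dist_nonneg

theorem edgeLength_nonneg {X V : Type*} [PseudoMetricSpace X] (p : ℝ) (A : V → Set X)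
    (i j : V) : 0 ≤ setDist (A i) (A j) ^ p :=
  Real.rpow_nonneg (setDist_nonneg _ _) p

theorem setDist_le {X : Type*} [PseudoMetricSpace X] {A B : Set X} {x y : X} (hx : x ∈ A)
    (hy : y ∈ B) : setDist A B ≤ dist x y := by
  refine csInf_le ⟨0, ?_⟩ ⟨x, hx, y, hy, rfl⟩
  rintro r ⟨x, -, y, -, rfl⟩
  exact dist_nonneg

theorem exists_dist_eq_setDist {X : Type*} [PseudoMetricSpace X] {A B : Set X} (hA : IsCompact A)
    (hB : IsCompact B) (hAne : A.Nonempty) (hBne : B.Nonempty) :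
    ∃ x ∈ A, ∃ y ∈ B, setDist A B = dist x y := by
  have h : {r | ∃ x ∈ A, ∃ y ∈ B, r = dist x y} = (fun z : X × X => dist z.1 z.2) '' (A ×ˢ B) := by
    ext r
    constructor
    · rintro ⟨x, hx, y, hy, rfl⟩
      exact ⟨(x, y), ⟨hx, hy⟩, rfl⟩
    · rintro ⟨z, hz, rfl⟩
      exact ⟨z.1, hz.1, z.2, hz.2, rfl⟩
  have hmem : setDist A B ∈ {r | ∃ x ∈ A, ∃ y ∈ B, r = dist x y} := by
    rw [setDist, h]
    exact ((hA.prod hB).image continuous_dist).sInf_mem ((hAne.prod hBne).image _)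
  exact hmem

/-- The geodesic distance is the largest premetric below the edge lengths. -/
theorem le_ofReal_geodesic {V : Type*} {E : V → V → ℝ} (hE : ∀ i j, 0 ≤ E i j)
    (δ : V → V → ℝ≥0∞) (h0 : ∀ i, δ i i = 0) (htri : ∀ i j k, δ i k ≤ δ i j + δ j k)
    (hedge : ∀ i j, δ i j ≤ ENNReal.ofReal (E i j)) (i j : V) :
    δ i j ≤ ENNReal.ofReal (geodesic E i j) := by
  refine le_ofReal_csInf (geodesic_set_nonempty i j) ?_ ?_
  · rintro r ⟨n, k, -, -, rfl⟩
    exact Finset.sum_nonneg fun l _ => hE _ _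
  · rintro r ⟨n, k, rfl, rfl, rfl⟩
    rw [ENNReal.ofReal_sum_of_nonneg fun l _ => hE _ _]
    exact (le_sum_chain Set.univ δ (fun i _ => h0 i) (fun i _ j _ k _ => htri i j k) n k
      fun _ => Set.mem_univ _).trans (Finset.sum_le_sum fun l _ => hedge _ _)

/-! ### The two bounds and the limit. -/

section Components

variable {X : Type*} [MeasurableSpace X] [MetricSpace X] [BorelSpace X]
  [SecondCountableTopology X] {V : Type*}

/-- Travel within `A` and `B` is free, so the path may go through a closest pair of points. -/
theorem pointCost_le_edge {p : ℝ} (hp : 0 < p) {μ : Measure X} [IsFiniteMeasure μ]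
    {A B : Set X} (hA : IsCompact A) (hB : IsCompact B) (hAμ : A ⊆ μ.support)
    (hBμ : B ⊆ μ.support) {x y : X} (hx : x ∈ A) (hy : y ∈ B)
    (hA0 : ∀ u ∈ A, pointCost p μ x u = 0) (hB0 : ∀ v ∈ B, pointCost p μ v y = 0) :
    pointCost p μ x y ≤ ENNReal.ofReal (setDist A B ^ p) := by
  obtain ⟨u, hu, v, hv, huv⟩ := exists_dist_eq_setDist hA hB ⟨_, hx⟩ ⟨_, hy⟩
  have h1 := pointCost_triangle p x y (hAμ hu)
  have h2 := pointCost_triangle p u y (hBμ hv)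
  rw [hA0 u hu, zero_add] at h1
  rw [hB0 v hv, add_zero] at h2
  rw [huv, ← ENNReal.ofReal_rpow_of_nonneg dist_nonneg hp.le, ← edist_dist]
  exact h1.trans (h2.trans (pointCost_le hp.le (hAμ hu) (hBμ hv)))

theorem pointCost_le_geodesic {p : ℝ} (hp : 0 < p) {μ : Measure X} [IsFiniteMeasure μ]
    {A : V → Set X} (hA : ∀ j, IsCompact (A j)) (hAμ : ∀ j, A j ⊆ μ.support)
    (h0 : ∀ j, ∀ x ∈ A j, ∀ y ∈ A j, pointCost p μ x y = 0) {x : V → X} (hx : ∀ j, x j ∈ A j)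
    (i j : V) :
    pointCost p μ (x i) (x j) ≤
      ENNReal.ofReal (geodesic (fun i j => setDist (A i) (A j) ^ p) i j) := by
  have hedge : ∀ i j, pointCost p μ (x i) (x j) ≤ ENNReal.ofReal (setDist (A i) (A j) ^ p) := by
    intro i j
    exact pointCost_le_edge hp (hA i) (hA j) (hAμ i) (hAμ j) (hx i) (hx j)
      (fun u hu => h0 i _ (hx i) u hu) fun v hv => h0 j v hv _ (hx j)
  exact le_ofReal_geodesic (edgeLength_nonneg p A) (fun i j => pointCost p μ (x i) (x j))
    (fun i => pointCost_self hp μ (x i))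
    (fun i j l => pointCost_triangle p (x i) (x l) (hAμ j (hx j))) hedge i j

variable [Fintype V]

theorem sum_measure_inter_eq {Y : Type*} [MeasurableSpace Y] {α : Measure Y} {B : V → Set Y}
    (hB : ∀ i, MeasurableSet (B i)) (hd : Pairwise (Function.onFun Disjoint B))
    (h : α (⋃ i, B i)ᶜ = 0) {s : Set Y} (hs : MeasurableSet s) : ∑ i, α (s ∩ B i) = α s := by
  conv_rhs => rw [eq_sum_restrict (α := α) Finset.univ (fun i _ => hB i)
    (fun i _ j _ hij => hd hij) (by simpa using h)]
  simp [Measure.finsetSum_apply, Measure.restrict_apply hs]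

theorem sum_measureReal_eq {Y : Type*} [MeasurableSpace Y] {α : Measure Y} [IsFiniteMeasure α]
    {B : V → Set Y} (hB : ∀ i, MeasurableSet (B i)) (hd : Pairwise (Function.onFun Disjoint B))
    (h : α (⋃ i, B i)ᶜ = 0) : ∑ i, α.real (B i) = (α Set.univ).toReal := by
  rw [← sum_measure_inter_eq hB hd h MeasurableSet.univ,
    ENNReal.toReal_sum fun i _ => measure_ne_top _ _]
  simp [measureReal_def]

/-- A finite measure on the union of the components can be collapsed to one point for each
component at asymptotically no cost. -/
theorem limsup_catalyticCost_collapse_sum {p : ℝ} (hp : 0 < p) {μ α : Measure X}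
    [IsFiniteMeasure μ] [IsFiniteMeasure α] {A : V → Set X} (hA : ∀ j, IsCompact (A j))
    (hd : Pairwise (Function.onFun Disjoint A)) (hAμ : ∀ j, A j ⊆ μ.support)
    (h0 : ∀ j, ∀ x ∈ A j, ∀ y ∈ A j, pointCost p μ x y = 0) {x : V → X} (hx : ∀ j, x j ∈ A j)
    (hα : α (⋃ j, A j)ᶜ = 0) :
    limsup (fun r : ℝ => catalyticCost p μ α
      (∑ j, ENNReal.ofReal (α.real (A j)) • smear μ (x j) r)) (𝓝[>] 0) = 0 := by
  have hsum : α = ∑ j, α.restrict (A j) :=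
    eq_sum_restrict Finset.univ (fun j _ => (hA j).isClosed.measurableSet)
      (fun i _ j _ hij => hd hij) (by simpa using hα)
  refine nonpos_iff_eq_zero.1 ((limsup_le_limsup (Eventually.of_forall fun r : ℝ => ?_)).trans
    ((limsup_sum_mul_le Finset.univ (m := fun _ : V => 1) (fun _ => ENNReal.one_ne_top)
      fun j r => catalyticCost p μ (α.restrict (A j))
        ((α.restrict (A j)) Set.univ • smear μ (x j) r)).trans_eq ?_))
  · have h := catalyticCost_sum_le p μ Finset.univ (fun j => α.restrict (A j))
      fun j => (α.restrict (A j)) Set.univ • smear μ (x j) r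
    rw [← hsum] at h
    simpa [measureReal_def] using h
  · refine Finset.sum_eq_zero fun j _ => ?_
    rw [limsup_catalyticCost_collapse hp (hA j) (hAμ j) ?_ (hx j) fun y hy => h0 j y hy _ (hx j),
      mul_zero]
    rw [Measure.restrict_apply (hA j).isClosed.measurableSet.compl]
    simp

/-- For any plan Λ, go from `νp` to its collapse, along Λ to the collapse of `νm`, and back out to
`νm`. As `r → 0` only the middle leg costs. -/
theorem catalyticCost_le_teleportCost {p : ℝ} (hp : 0 < p) {μ νp νm : Measure X}
    [IsFiniteMeasure μ] [IsFiniteMeasure νp] [IsFiniteMeasure νm] (hbal : νp Set.univ = νm Set.univ)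
    {A : V → Set X} (hA : ∀ j, IsCompact (A j)) (hne : ∀ j, (A j).Nonempty)
    (hd : Pairwise (Function.onFun Disjoint A)) (hAμ : ∀ j, A j ⊆ μ.support)
    (h0 : ∀ j, ∀ x ∈ A j, ∀ y ∈ A j, pointCost p μ x y = 0)
    (hνp : νp (⋃ j, A j)ᶜ = 0) (hνm : νm (⋃ j, A j)ᶜ = 0) :
    catalyticCost p μ νp νm ≤ ENNReal.ofReal (teleportCost p A νp νm) := by
  choose x hx using hne
  have hE := edgeLength_nonneg p A
  have hmeas : ∀ j, MeasurableSet (A j) := fun j => (hA j).isClosed.measurableSet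
  have hnonempty : (transportPlans fun j => νp.real (A j) - νm.real (A j)).Nonempty :=
    transportPlans_nonempty (fun _ => measureReal_nonneg) (fun _ => measureReal_nonneg) (by
      rw [sum_measureReal_eq hmeas hd hνp, sum_measureReal_eq hmeas hd hνm, hbal])
  obtain ⟨Λ₀, hΛ₀⟩ := hnonempty
  unfold teleportCost graphCost
  refine le_ofReal_csInf ?_ ?_ ?_
  · exact ⟨_, Λ₀, hΛ₀, rfl⟩
  · rintro r ⟨Λ, hΛ, rfl⟩
    exact Finset.sum_nonneg fun i _ => Finset.sum_nonneg fun j _ =>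
      mul_nonneg (hΛ.1 i j) (geodesic_nonneg hE _ _)
  · rintro r ⟨Λ, hΛ, rfl⟩
    let S : ℝ → Measure X → Measure X := fun r α =>
      ∑ j, ENNReal.ofReal (α.real (A j)) • smear μ (x j) r
    have hS : ∀ r : ℝ, 0 < r → ∀ α, IsCatalyst μ (S r α) := fun r hr α =>
      IsCatalyst.sum _ fun j _ =>
        (isCatalyst_smear (hAμ j (hx j)) hr).smul ENNReal.ofReal_ne_top
    have hpt : ∀ᶠ r : ℝ in 𝓝[>] 0, catalyticCost p μ νp νm ≤
        (catalyticCost p μ νp (S r νp) + ∑ z : {i : V // 0 < νp.real (A i) - νm.real (A i)} ×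
          {j : V // νp.real (A j) - νm.real (A j) < 0}, ENNReal.ofReal (Λ z.1 z.2) *
            catalyticCost p μ (smear μ (x z.1) r) (smear μ (x z.2) r)) +
        catalyticCost p μ νm (S r νm) := by
      filter_upwards [self_mem_nhdsWithin] with r hr
      refine (catalyticCost_triangle p νp νm (hS r hr νm)).trans
        (add_le_add ?_ (catalyticCost_comm p _ _ _).le)
      refine (catalyticCost_triangle p νp _ (hS r hr νp)).trans (add_le_add le_rfl ?_)
      exact catalyticCost_plan_le hp μ (fun j => smear μ (x j) r)
        (fun _ => measureReal_nonneg) (fun _ => measureReal_nonneg) hΛ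
    have hlim := limsup_le_limsup hpt
    rw [limsup_const] at hlim
    refine hlim.trans ((limsup_add_le_add _ _).trans ?_)
    rw [limsup_catalyticCost_collapse_sum hp hA hd hAμ h0 hx hνm, add_zero]
    refine (limsup_add_le_add _ _).trans ?_
    rw [limsup_catalyticCost_collapse_sum hp hA hd hAμ h0 hx hνp, zero_add]
    refine (limsup_sum_mul_le _ (fun z => ENNReal.ofReal_ne_top) _).trans ?_
    rw [← Fintype.sum_prod_type' (f := fun (i : {i : V // 0 < νp.real (A i) - νm.real (A i)})
        (j : {j : V // νp.real (A j) - νm.real (A j) < 0}) =>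
        Λ i j * geodesic (fun i j => setDist (A i) (A j) ^ p) i j),
      ENNReal.ofReal_sum_of_nonneg fun z _ => mul_nonneg (hΛ.1 _ _) (geodesic_nonneg hE _ _)]
    refine Finset.sum_le_sum fun z _ => ?_
    rw [ENNReal.ofReal_mul (hΛ.1 _ _)]
    gcongr
    exact pointCost_le_geodesic hp hA hAμ h0 hx _ _

theorem mul_teleportCost_le_transportCost {p : ℝ} (hp : 0 < p) {μ νp νm : Measure X}
    [IsFiniteMeasure μ] [IsFiniteMeasure νp] [IsFiniteMeasure νm]
    {A : V → Set X} (hA : ∀ j, MeasurableSet (A j))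
    (hd : Pairwise (Function.onFun Disjoint A)) (hμ : μ (⋃ j, A j)ᶜ = 0)
    (hνp : νp (⋃ j, A j)ᶜ = 0) (hνm : νm (⋃ j, A j)ᶜ = 0) {ε : ℝ} (hε : 0 < ε) :
    ENNReal.ofReal ε * ENNReal.ofReal (teleportCost p A νp νm) ≤
      transportCost p (μ + ENNReal.ofReal ε • νp) (μ + ENNReal.ofReal ε • νm) := by
  have hE := edgeLength_nonneg p A
  refine le_iInf₂ fun π hπ => ?_
  have hfst : ∀ s, MeasurableSet s →
      π (Prod.fst ⁻¹' s) = μ s + ENNReal.ofReal ε * νp s := fun s hs => by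
    rw [← Measure.map_apply measurable_fst hs, hπ.1]; simp
  have hsnd : ∀ s, MeasurableSet s →
      π (Prod.snd ⁻¹' s) = μ s + ENNReal.ofReal ε * νm s := fun s hs => by
    rw [← Measure.map_apply measurable_snd hs, hπ.2]; simp
  have hUm : MeasurableSet (⋃ j, A j)ᶜ := (MeasurableSet.iUnion hA).compl
  have hfin : IsFiniteMeasure π := ⟨by
    rw [← Set.preimage_univ (f := Prod.fst), hfst _ MeasurableSet.univ]
    finiteness⟩
  have hrow : ∀ i, ∑ j, π (A i ×ˢ A j) = μ (A i) + ENNReal.ofReal ε * νp (A i) := fun i => by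
    rw [← hfst _ (hA i), ← sum_measure_inter_eq (B := fun j => Prod.snd ⁻¹' A j)
      (fun j => measurable_snd (hA j)) (fun i j hij => (hd hij).preimage _) _
      (measurable_fst (hA i))]
    · rfl
    · rw [← Set.preimage_iUnion, ← Set.preimage_compl, hsnd _ hUm, hμ, hνm]; simp
  have hcol : ∀ j, ∑ i, π (A i ×ˢ A j) = μ (A j) + ENNReal.ofReal ε * νm (A j) := fun j => by
    rw [← hsnd _ (hA j), ← sum_measure_inter_eq (B := fun i => Prod.fst ⁻¹' A i)
      (fun i => measurable_fst (hA i)) (fun i j hij => (hd hij).preimage _) _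
      (measurable_snd (hA j))]
    · refine Finset.sum_congr rfl fun i _ => ?_
      rw [Set.inter_comm]; rfl
    · rw [← Set.preimage_iUnion, ← Set.preimage_compl, hfst _ hUm, hμ, hνp]; simp
  have hrow' : ∀ i, ∑ j, π.real (A i ×ˢ A j) = μ.real (A i) + ε * νp.real (A i) := fun i => by
    simp only [measureReal_def]
    rw [← ENNReal.toReal_sum fun j _ => measure_ne_top _ _, hrow,
      ENNReal.toReal_add (by finiteness) (by finiteness), ENNReal.toReal_mul,
      ENNReal.toReal_ofReal hε.le]
  have hcol' : ∀ j, ∑ i, π.real (A i ×ˢ A j) = μ.real (A j) + ε * νm.real (A j) := fun j => by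
    simp only [measureReal_def]
    rw [← ENNReal.toReal_sum fun j _ => measure_ne_top _ _, hcol,
      ENNReal.toReal_add (by finiteness) (by finiteness), ENNReal.toReal_mul,
      ENNReal.toReal_ofReal hε.le]
  -- The flow `π (A i ×ˢ A j) / ε` has the charges of `νp - νm` as its divergence, since μ enters
  -- row and column sums equally.
  have hgraph : teleportCost p A νp νm ≤
      ∑ i, ∑ j, π.real (A i ×ˢ A j) / ε * setDist (A i) (A j) ^ p := by
    refine (graphCost_le_of_flow (geodesic_nonneg hE) (geodesic_triangle hE)
      (f := fun i j => π.real (A i ×ˢ A j) / ε)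
      (fun i j => div_nonneg measureReal_nonneg hε.le) fun i => ?_).trans ?_
    · rw [← Finset.sum_div, ← Finset.sum_div, hrow', hcol']
      field_simp
      ring
    · exact Finset.sum_le_sum fun i _ => Finset.sum_le_sum fun j _ =>
        mul_le_mul_of_nonneg_left (geodesic_le hE i j) (div_nonneg measureReal_nonneg hε.le)
  have hprod : ∀ z : V × V, MeasurableSet (A z.1 ×ˢ A z.2) := fun z => (hA _).prod (hA _)
  have hind : ∑ z : V × V, ENNReal.ofReal (setDist (A z.1) (A z.2) ^ p) * π (A z.1 ×ˢ A z.2) ≤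
      ∫⁻ z, edist z.1 z.2 ^ p ∂π := by
    calc ∑ z : V × V, ENNReal.ofReal (setDist (A z.1) (A z.2) ^ p) * π (A z.1 ×ˢ A z.2)
        ≤ ∑ z : V × V, ∫⁻ w in A z.1 ×ˢ A z.2, edist w.1 w.2 ^ p ∂π := by
          refine Finset.sum_le_sum fun z _ => ?_
          rw [← setLIntegral_const]
          refine setLIntegral_mono' (hprod z) fun w hw => ?_
          rw [edist_dist, ENNReal.ofReal_rpow_of_nonneg dist_nonneg hp.le]
          exact ENNReal.ofReal_le_ofReal
            (Real.rpow_le_rpow (setDist_nonneg _ _) (setDist_le hw.1 hw.2) hp.le)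
      _ = ∫⁻ w in ⋃ z ∈ (Finset.univ : Finset (V × V)), A z.1 ×ˢ A z.2, edist w.1 w.2 ^ p ∂π := by
          rw [lintegral_biUnion_finset (fun z _ w _ hzw => ?_) fun z _ => hprod z]
          rw [Function.onFun, Set.disjoint_prod]
          by_cases h1 : z.1 = w.1
          · exact Or.inr (hd fun h2 => hzw (Prod.ext h1 h2))
          · exact Or.inl (hd h1)
      _ ≤ ∫⁻ z, edist z.1 z.2 ^ p ∂π := setLIntegral_le_lintegral _ _
  refine le_trans ?_ hind
  rw [← ENNReal.ofReal_mul hε.le, Fintype.sum_prod_type]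
  refine (ENNReal.ofReal_le_ofReal (mul_le_mul_of_nonneg_left hgraph hε.le)).trans (le_of_eq ?_)
  rw [Finset.mul_sum, ENNReal.ofReal_sum_of_nonneg fun i _ => mul_nonneg hε.le
    (Finset.sum_nonneg fun j _ => mul_nonneg (div_nonneg measureReal_nonneg hε.le) (hE i j))]
  refine Finset.sum_congr rfl fun i _ => ?_
  rw [Finset.mul_sum, ENNReal.ofReal_sum_of_nonneg fun j _ => mul_nonneg hε.le
    (mul_nonneg (div_nonneg measureReal_nonneg hε.le) (hE i j))]
  refine Finset.sum_congr rfl fun j _ => ?_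
  rw [← ofReal_measureReal (μ := π) (s := A i ×ˢ A j), ← ENNReal.ofReal_mul (hE i j)]
  congr 1
  field_simp

theorem tendsto_wasserstein_teleport {p : ℝ} (hp : 0 < p) {μ νp νm : Measure X}
    [IsFiniteMeasure μ] [IsFiniteMeasure νp] [IsFiniteMeasure νm] (hbal : νp Set.univ = νm Set.univ)
    {A : V → Set X} (hA : ∀ j, IsCompact (A j)) (hne : ∀ j, (A j).Nonempty)
    (hd : Pairwise (Function.onFun Disjoint A)) (hμ : μ.support = ⋃ j, A j)
    (h0 : ∀ j, ∀ x ∈ A j, ∀ y ∈ A j, pointCost p μ x y = 0)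
    (hνp : νp.support ⊆ μ.support) (hνm : νm.support ⊆ μ.support) :
    Tendsto
      (fun ε : ℝ => ENNReal.ofReal (ε ^ (-(1 / p))) *
        wasserstein p (μ + ENNReal.ofReal ε • νp) (μ + ENNReal.ofReal ε • νm))
      (𝓝[>] 0) (𝓝 (ENNReal.ofReal (teleportCost p A νp νm ^ (1 / p)))) := by
  have hnull : ∀ α : Measure X, α.support ⊆ μ.support → α (⋃ j, A j)ᶜ = 0 := fun α hα => by
    rw [← hμ]
    exact measure_mono_null (Set.compl_subset_compl.2 hα) Measure.measure_compl_support
  have hpinv : 0 ≤ 1 / p := by positivity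
  have hG : 0 ≤ teleportCost p A νp νm :=
    graphCost_nonneg (geodesic_nonneg (edgeLength_nonneg p A)) _
  have hupper := catalyticCost_le_teleportCost hp hbal hA hne hd
    (fun j => hμ ▸ Set.subset_iUnion A j) h0 (hnull _ hνp) (hnull _ hνm)
  -- The limit is taken for `p`-th powers, where the lower bound holds for every ε; the root follows
  -- by continuity.
  have hlim : Tendsto (fun ε : ℝ => ENNReal.ofReal ε⁻¹ *
      transportCost p (μ + ENNReal.ofReal ε • νp) (μ + ENNReal.ofReal ε • νm))
      (𝓝[>] 0) (𝓝 (ENNReal.ofReal (teleportCost p A νp νm))) := by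
    have hcancel : ∀ ε : ℝ, 0 < ε → ENNReal.ofReal ε⁻¹ * ENNReal.ofReal ε = 1 := fun ε hε => by
      rw [← ENNReal.ofReal_mul (inv_nonneg.2 hε.le), inv_mul_cancel₀ hε.ne', ENNReal.ofReal_one]
    refine tendsto_order.2 ⟨fun a ha => ?_, fun a ha => ?_⟩
    · filter_upwards [self_mem_nhdsWithin] with ε hε
      refine ha.trans_le ?_
      have h := mul_teleportCost_le_transportCost hp (fun j => (hA j).isClosed.measurableSet) hd
        (hnull _ subset_rfl) (hnull _ hνp) (hnull _ hνm) hε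
      calc _ = ENNReal.ofReal ε⁻¹ * (ENNReal.ofReal ε *
            ENNReal.ofReal (teleportCost p A νp νm)) := by
            rw [← mul_assoc, hcancel ε hε, one_mul]
        _ ≤ _ := by gcongr
    -- A single catalyst `F` of cost below `a` serves for all small ε.
    · have hlt := hupper.trans_lt ha
      simp only [catalyticCost, iInf_lt_iff] at hlt
      obtain ⟨F, hF, hlt⟩ := hlt
      filter_upwards [eventually_transportCost_le hp hF νp νm, self_mem_nhdsWithin] with ε h hε
      calc _ ≤ ENNReal.ofReal ε⁻¹ * (ENNReal.ofReal ε * transportCost p (νp + F) (νm + F)) := by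
            gcongr
        _ = transportCost p (νp + F) (νm + F) := by rw [← mul_assoc, hcancel ε hε, one_mul]
        _ < a := hlt
  rw [← ENNReal.ofReal_rpow_of_nonneg hG hpinv]
  refine ((ENNReal.continuous_rpow_const.tendsto _).comp hlim).congr' ?_
  filter_upwards [self_mem_nhdsWithin] with ε hε
  have hε : 0 < ε := hε
  rw [Function.comp_apply, ENNReal.mul_rpow_of_nonneg _ _ hpinv, wasserstein_eq,
    ENNReal.ofReal_rpow_of_nonneg (inv_nonneg.2 hε.le) hpinv, Real.rpow_neg hε.le,
    Real.inv_rpow hε.le]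

end Components

end Teleportation

end

theorem theorem3 {k m : ℕ} (hm : 2 ≤ m) (p : ℝ) (hp : 1 < p)
    (Ω : Set (EuclideanSpace ℝ (Fin k))) (hΩ : IsCompact Ω)
    (μ : Measure (EuclideanSpace ℝ (Fin k))) [IsProbabilityMeasure μ] (hμΩ : μ Ωᶜ = 0)
    (μc : Fin m → Measure (EuclideanSpace ℝ (Fin k)))
    (hμ : μ = ∑ j, μc j) (hne : ∀ j, μc j ≠ 0)
    (hdisj : ∀ i j, i ≠ j → Disjoint (μc i).support (μc j).support)
    (hconn : ∀ j, ∃ d : ℝ, 1 ≤ d ∧ Teleportation.IsStronglyConnected d (μc j))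
    (νp νm : Measure (EuclideanSpace ℝ (Fin k))) [IsFiniteMeasure νp] [IsFiniteMeasure νm]
    (hbal : νp Set.univ = νm Set.univ)
    (hνp : νp.support ⊆ μ.support) (hνm : νm.support ⊆ μ.support) :
    Tendsto
      (fun ε : ℝ => ENNReal.ofReal (ε ^ (-(1 / p))) *
        Teleportation.wasserstein p
          (μ + ENNReal.ofReal ε • νp) (μ + ENNReal.ofReal ε • νm))
      (𝓝[>] 0)
      (𝓝 (ENNReal.ofReal
        (Teleportation.teleportCost p (fun j => (μc j).support) νp νm ^ (1 / p)))) := by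
  have hsupp : μ.support = ⋃ j, (μc j).support := by
    rw [hμ, Teleportation.support_sum]
    simp
  have hsub : ∀ j, (μc j).support ⊆ μ.support := fun j =>
    hsupp ▸ Set.subset_iUnion (fun j => (μc j).support) j
  have hμΩ' : μ.support ⊆ Ω := Measure.support_subset_of_isClosed hΩ.isClosed hμΩ
  refine Teleportation.tendsto_wasserstein_teleport (by linarith) hbal
    (fun j => hΩ.of_isClosed_subset Measure.isClosed_support ((hsub j).trans hμΩ'))
    (fun j => Measure.nonempty_support (hne j)) (fun i j hij => hdisj i j hij) hsupp
    (fun j x hx y hy => ?_) hνp hνm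
  obtain ⟨d, -, hd⟩ := hconn j
  exact hd.pointCost_eq_zero hp (hsub j) hx hy
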